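/- **Conventions.** Distances are extended metrics (they may take the value $+\infty$). Let $\epsilon>0$. A map $f:X\to Y$, not necessarily continuous, is *$\epsilon$-continuous* if there is $\delta>0$ with $\sup\{d_Y(f(x_1),f(x_2)) : d_X(x_1,x_2)<\delta\}<\epsilon$. Let $\Delta^n\subset\mathbb{R}^{n+1}$ be the standard simplex. Let $C_n^{\epsilon}(X)$ be the free abelian group on the $\epsilon$-continuous maps $\Delta^n\to X$, with the boundary $\partial\sigma=\sum_{i=0}^n(-1)^i\,\sigma|[v_0,\dots,\widehat{v_i},\dots,v_n]$ of singular homology theory, and let $H_n^{\epsilon}(X)$ be the homology of $(C_*^{\epsilon}(X),\partial)$. For $0<\mu\le\epsilon$ the inclusion $C_*^{\mu}(X)\subseteq C_*^{\epsilon}(X)$ induces $\varphi_{\mu\epsilon*}:H_n^{\mu}(X)\to H_n^{\epsilon}(X)$, and one sets $$H_n^{lc}(X)=\Bigl\{(a_\epsilon)_{\epsilon>0}\in\prod_{\epsilon>0}H_n^{\epsilon}(X) : a_\epsilon=\varphi_{\mu\epsilon*}(a_\mu)\text{ for all }0<\mu\le\epsilon\Bigr\}.$$ For every $\epsilon>0$,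 all continuous maps $\Delta^n\to X$ are $\epsilon$-continuous; this gives natural maps $H_n(X)\to H_n^{\epsilon}(X)$ and $H_n(X)\to H_n^{lc}(X)$ from singular homology with integer coefficients. The group $H_n^{lc}(X)$ is *stable* if there is $\epsilon>0$ such that $\varphi_{\epsilon_2\epsilon_1*}$ is an isomorphism for all $0<\epsilon_2\le\epsilon_1\le\epsilon$. **Theorem.** Let $X$ be a compact smooth manifold without boundary, of dimension $d\ge 0$, endowed with a smooth Riemannian metric, and let $X$ carry the induced Riemannian distance, that is, the infimum of the lengths of $C^1$ paths (points in different connected components have distance $+\infty$). Then: 1. the natural map $H_n(X)\to H_n^{lc}(X)$ is an isomorphism for every $n\ge 0$; 2. there is $\delta>0$ such that for every $0<\epsilon<\delta$ and every $n\ge 0$ the natural map $H_n(X)\to H_n^{\epsilon}(X)$ is an isomorphism; 3. for every $n\ge 0$ the group $H_n^{lc}(X)$ is stable. -/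

import Mathlib

open CategoryTheory
open scoped ContDiff Manifold Bundle

noncomputable section

namespace ScaledHomology

universe u

/-- A (not necessarily continuous) map `f` is `ε`-continuous if for some `δ > 0`
`sup {d (f x₁) (f x₂) | d x₁ x₂ < δ} < ε`. The supremum is taken in `[0, ∞]`, so that it is the
honest one; distances are allowed to be infinite. -/
def EpsContinuous {X Y : Type*} [PseudoEMetricSpace X] [PseudoEMetricSpace Y]
    (ε : ℝ) (f : X → Y) : Prop :=
  ∃ δ : ℝ, 0 < δ ∧
    (⨆ (x₁ : X) (x₂ : X) (_ : edist x₁ x₂ < ENNReal.ofReal δ), edist (f x₁) (f x₂))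
      < ENNReal.ofReal ε

theorem EpsContinuous.mono {X Y : Type*} [PseudoEMetricSpace X] [PseudoEMetricSpace Y]
    {μ ε : ℝ} (h : μ ≤ ε) {f : X → Y} (hf : EpsContinuous μ f) : EpsContinuous ε f := by
  obtain ⟨δ, hδ, hlt⟩ := hf
  exact ⟨δ, hδ, hlt.trans_le (ENNReal.ofReal_le_ofReal h)⟩

theorem EpsContinuous.comp_uniformContinuous {X Y Z : Type*} [PseudoEMetricSpace X]
    [PseudoEMetricSpace Y] [PseudoEMetricSpace Z] {ε : ℝ} {f : Y → Z} {g : X → Y}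
    (hf : EpsContinuous ε f) (hg : UniformContinuous g) : EpsContinuous ε (f ∘ g) := by
  obtain ⟨δ, hδ, hlt⟩ := hf
  obtain ⟨η, hη, hηδ⟩ := EMetric.uniformContinuous_iff.1 hg (ENNReal.ofReal δ)
    (ENNReal.ofReal_pos.2 hδ)
  obtain ⟨r, hr, hrη⟩ := ENNReal.lt_iff_exists_real_btwn.1 hη
  refine ⟨r, ENNReal.ofReal_pos.1 hrη.1, lt_of_le_of_lt ?_ hlt⟩
  refine iSup_le fun x₁ => iSup_le fun x₂ => iSup_le fun h => ?_
  exact le_iSup_of_le (g x₁) (le_iSup_of_le (g x₂)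
    (le_iSup_of_le (hηδ (h.trans hrη.2)) le_rfl))

theorem EpsContinuous.of_uniformContinuous {X Y : Type*} [PseudoEMetricSpace X]
    [PseudoEMetricSpace Y] {ε : ℝ} (hε : 0 < ε) {f : X → Y} (hf : UniformContinuous f) :
    EpsContinuous ε f := by
  obtain ⟨η, hη, hηε⟩ := EMetric.uniformContinuous_iff.1 hf (ENNReal.ofReal (ε / 2))
    (ENNReal.ofReal_pos.2 (half_pos hε))
  obtain ⟨r, hr, hrη⟩ := ENNReal.lt_iff_exists_real_btwn.1 hη
  refine ⟨r, ENNReal.ofReal_pos.1 hrη.1, lt_of_le_of_lt ?_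
    ((ENNReal.ofReal_lt_ofReal_iff hε).2 (half_lt_self hε))⟩
  exact iSup_le fun x₁ => iSup_le fun x₂ => iSup_le fun h => (hηε (h.trans hrη.2)).le

/-- The simplicial set of `ε`-singular simplices of `X`: its `n`-simplices are the `ε`-continuous
maps `Δⁿ → X`, and its face maps are given by restriction to the faces of `Δⁿ`.
Here `Δⁿ = stdSimplex ℝ (Fin (n + 1))` carries the metric induced by the sup norm of `ℝⁿ⁺¹`;
`ε`-continuity only depends on the uniform structure of the source, so the Euclidean metric
gives the same simplices. -/
def epsSing (X : Type u) [PseudoEMetricSpace X] (ε : ℝ) : SSet.{u} where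
  obj n := {σ : stdSimplex ℝ (Fin (n.unop.len + 1)) → X // EpsContinuous ε σ}
  map g := ↾fun σ => ⟨σ.1 ∘ stdSimplex.map (S := ℝ) g.unop,
    σ.2.comp_uniformContinuous
      (CompactSpace.uniformContinuous_of_continuous (stdSimplex.continuous_map _))⟩
  map_id n := by
    refine ConcreteCategory.hom_ext _ _ fun σ => Subtype.ext ?_
    change σ.1 ∘ stdSimplex.map (S := ℝ) id = σ.1
    exact funext fun x => congrArg σ.1 (stdSimplex.map_id_apply x)
  map_comp {a b c} f g := by
    refine ConcreteCategory.hom_ext _ _ fun σ => Subtype.ext ?_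
    change σ.1 ∘ stdSimplex.map (S := ℝ) (f.unop ∘ g.unop) =
      (σ.1 ∘ stdSimplex.map (S := ℝ) f.unop) ∘ stdSimplex.map (S := ℝ) g.unop
    exact funext fun x => congrArg σ.1 (stdSimplex.map_comp_apply _ _ x).symm

/-- A `μ`-singular simplex is an `ε`-singular simplex if `μ ≤ ε`. -/
def epsSingIncl (X : Type u) [PseudoEMetricSpace X] {μ ε : ℝ} (h : μ ≤ ε) :
    epsSing X μ ⟶ epsSing X ε where
  app _ := ↾fun σ => ⟨σ.1, σ.2.mono h⟩

/-- A (continuous) singular simplex is an `ε`-singular simplex for every `ε > 0`. -/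
def singToEpsSing (X : Type u) [PseudoEMetricSpace X] {ε : ℝ} (hε : 0 < ε) :
    TopCat.toSSet.obj (TopCat.of X) ⟶ epsSing X ε where
  app n := ↾fun σ => ⟨TopCat.toSSetObjEquiv (TopCat.of X) n σ,
    EpsContinuous.of_uniformContinuous hε
      (CompactSpace.uniformContinuous_of_continuous (ContinuousMap.continuous _))⟩

/-- The coefficient group `ℤ` (in an arbitrary universe). -/
abbrev coeffZ : AddCommGrpCat.{u} := AddCommGrpCat.of (ULift.{u} ℤ)

/-- Singular homology `H_n(X)` with integral coefficients. -/
abbrev singularHomology (X : Type u) [TopologicalSpace X] (n : ℕ) : AddCommGrpCat.{u} :=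
  ((AlgebraicTopology.singularHomologyFunctor (AddCommGrpCat.{u}) n).obj coeffZ).obj (TopCat.of X)

/-- The `ε`-homology `H_n^ε(X)`: the homology of the chain complex which in degree `n` is the free
abelian group (coproduct of copies of `ℤ`) on the `ε`-singular `n`-simplices, with boundary the
alternating sum of the faces. -/
abbrev epsHomology (X : Type u) [PseudoEMetricSpace X] (ε : ℝ) (n : ℕ) : AddCommGrpCat.{u} :=
  (epsSing X ε).homology coeffZ n

/-- The map `H_n^μ(X) → H_n^ε(X)`, `μ ≤ ε`, induced by the inclusion of chain complexes. -/
def epsHomologyMap (X : Type u) [PseudoEMetricSpace X] {μ ε : ℝ} (h : μ ≤ ε) (n : ℕ) :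
    epsHomology X μ n →+ epsHomology X ε n :=
  (SSet.homologyMap (epsSingIncl X h) coeffZ n).hom

/-- The map `H_n(X) → H_n^ε(X)`, `0 < ε`, induced by the inclusion of chain complexes. -/
def singularToEps (X : Type u) [PseudoEMetricSpace X] {ε : ℝ} (hε : 0 < ε) (n : ℕ) :
    singularHomology X n →+ epsHomology X ε n :=
  (SSet.homologyMap (singToEpsSing X hε) coeffZ n).hom

/-- The `lc`-homology `H_n^{lc}(X)`: the inverse limit over `ε > 0` of the groups `H_n^ε(X)`,
i.e. the group of all compatible families in the product. -/
def lcHomology (X : Type u) [PseudoEMetricSpace X] (n : ℕ) :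
    AddSubgroup (∀ ε : Set.Ioi (0 : ℝ), epsHomology X (ε : ℝ) n) where
  carrier := {a | ∀ (μ ε : Set.Ioi (0 : ℝ)) (h : (μ : ℝ) ≤ (ε : ℝ)),
    a ε = epsHomologyMap X h n (a μ)}
  add_mem' ha hb μ ε h := by
    simp only [Pi.add_apply, map_add, ← ha μ ε h, ← hb μ ε h]
  zero_mem' μ ε h := by simp
  neg_mem' ha μ ε h := by
    simp only [Pi.neg_apply, map_neg, ← ha μ ε h]

theorem singularToEps_compat (X : Type u) [PseudoEMetricSpace X] {μ ε : ℝ} (hμ : 0 < μ)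
    (hε : 0 < ε) (h : μ ≤ ε) (n : ℕ) (a : singularHomology X n) :
    singularToEps X hε n a = epsHomologyMap X h n (singularToEps X hμ n a) := by
  have hc : singToEpsSing X hε = singToEpsSing X hμ ≫ epsSingIncl X h := rfl
  unfold singularToEps epsHomologyMap
  rw [hc, SSet.homologyMap_comp]
  rfl

/-- The natural map `H_n(X) → H_n^{lc}(X)`, whose components are the natural maps
`H_n(X) → H_n^ε(X)`. -/
def singularToLc (X : Type u) [PseudoEMetricSpace X] (n : ℕ) :
    singularHomology X n →+ lcHomology X n :=
  (AddMonoidHom.pi fun ε : Set.Ioi (0 : ℝ) => singularToEps X ε.2 n).codRestrict (lcHomology X n)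
    fun a μ ε h => singularToEps_compat X μ.2 ε.2 h n a

/-- The `n`-th `lc`-homology group is stable if the transition maps `H_n^{ε₂}(X) → H_n^{ε₁}(X)` are
isomorphisms for all sufficiently small `0 < ε₂ ≤ ε₁`. -/
def LcStable (X : Type u) [PseudoEMetricSpace X] (n : ℕ) : Prop :=
  ∃ ε : ℝ, 0 < ε ∧ ∀ (ε₁ ε₂ : ℝ) (h : ε₂ ≤ ε₁), 0 < ε₂ → ε₁ ≤ ε →
    Function.Bijective (epsHomologyMap X h n)

end ScaledHomology

end

noncomputable section

namespace ScaledHomology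

open Set Filter Topology
open scoped NNReal ENNReal

/-! The core is that $H_n(X)\to H_n^\epsilon(X)$ is bijective for every $\epsilon\le r$, with one
$r>0$ for all $n$ (`singularToEps_bijective`); the three claims then follow formally. For this,
finitely many $\epsilon$-continuous simplices must be deformed into continuous ones, compatibly with
faces, through $\epsilon$-continuous maps, and through continuous maps wherever the simplex was
already continuous.

Geometry: near each point a Riemannian manifold is bilipschitz to a convex set in a Euclidean space,
with constant as close to 1 as desired. In a Euclidean space a finite set of diameter $D$ lies
within $D/\sqrt2$ of a point of its convex hull. The room between $1/\sqrt2$ and 1 absorbs the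
distortion, so finite sets of small diameter $D$ have centers within $\kappa D$ of their points and
of the centers of their subsets, with $\kappa=15/16$ (`exists_hasCenters_of_isRiemannianManifold`).

Analysis: replace the value at $x$ by the center of the values at certain grid points near $x$. For
nearby points these grid sets are nested (`exists_heavyPoints_nested`), so jumps of size $D$ become
jumps of size $\kappa D$ (`eventually_fineMap_refineOp`). Iteration converges geometrically to a
continuous map (`exists_opHomotopic_continuous`). The homotopies are cheap: a sudden change of map
is allowed as long as all jumps stay below $\epsilon$. Continuous simplices are only reparametrized,
by a map collapsing neighbourhoods of faces onto the faces; the refinements leave the result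
untouched near every face on which the original simplex is continuous.

Algebra: the prism operator of such a natural homotopy compares chains of $\epsilon$-continuous and
of continuous maps. -/

/-- `X` has centers at scales below `r`, with ratio `κ`: one can assign to every finite set a point
in such a way that, for a set of diameter at most `D < r`, all its points and all the centers of
its subsets are at distance at most `κ * D` from its center. -/
def HasCenters (X : Type*) [PseudoEMetricSpace X] (r κ : ℝ≥0) : Prop :=
  ∃ c : Finset X → X, ∀ (T : Finset X) (D : ℝ≥0), T.Nonempty → D < r →
    (∀ s ∈ T, ∀ t ∈ T, edist s t ≤ D) →
    (∀ t ∈ T, edist t (c T) ≤ (κ * D : ℝ≥0)) ∧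
    ∀ T' ⊆ T, T'.Nonempty → edist (c T') (c T) ≤ (κ * D : ℝ≥0)

/-! ### Centers of finite sets in inner product spaces. -/

section Jung

variable {F : Type*} [NormedAddCommGroup F] [InnerProductSpace ℝ F]

theorem norm_lineMap_sq (a b : F) (s : ℝ) :
    ‖(1 - s) • a + s • b‖ ^ 2 = (1 - s) * ‖a‖ ^ 2 + s * ‖b‖ ^ 2 - s * (1 - s) * ‖b - a‖ ^ 2 := by
  rw [norm_add_sq_real, norm_sub_sq_real, norm_smul, norm_smul, inner_smul_left, inner_smul_right,
    mul_pow, mul_pow, Real.norm_eq_abs, Real.norm_eq_abs, sq_abs, sq_abs, real_inner_comm a b]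
  simp only [conj_trivial]
  ring

theorem sum_mul_norm_sub_sq {ι : Type*} [Fintype ι] (w : ι → ℝ) (hw : ∑ i, w i = 1) (t : ι → F)
    (a : F) : ∑ i, w i * ‖a - t i‖ ^ 2 =
      ‖a‖ ^ 2 - 2 * inner ℝ a (∑ i, w i • t i) + ∑ i, w i * ‖t i‖ ^ 2 := by
  have : ∀ i, w i * ‖a - t i‖ ^ 2 =
      w i * ‖a‖ ^ 2 - 2 * inner ℝ a (w i • t i) + w i * ‖t i‖ ^ 2 := fun i => by
    rw [norm_sub_sq_real, inner_smul_right]; ring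
  simp_rw [this, Finset.sum_add_distrib, Finset.sum_sub_distrib, ← Finset.mul_sum, ← inner_sum,
    ← Finset.sum_mul, hw, one_mul]

/-- A weak form of Jung's theorem, with the dimension free constant. -/
theorem exists_jung_center (T : Finset F) (hT : T.Nonempty) (D : ℝ)
    (hD : ∀ s ∈ T, ∀ t ∈ T, ‖s - t‖ ≤ D) :
    ∃ c ∈ convexHull ℝ (T : Set F), ∀ t ∈ T, ‖t - c‖ ^ 2 ≤ D ^ 2 / 2 := by
  classical
  have : Nonempty T := hT.to_subtype
  -- The variance of the probability distribution `w` on `T`; the center is the mean of a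
  -- distribution of maximal variance.
  let V : (T → ℝ) → ℝ := fun w => ∑ i, w i * ‖(i : F)‖ ^ 2 - ‖∑ i, w i • (i : F)‖ ^ 2
  have hV : Continuous V := by fun_prop
  obtain ⟨k₀⟩ := this
  obtain ⟨w, hw, hmax⟩ := (isCompact_stdSimplex ℝ T).exists_isMaxOn
    ⟨_, single_mem_stdSimplex ℝ k₀⟩ hV.continuousOn
  set c : F := ∑ i, w i • (i : F) with hc
  have hVw : V w ≤ D ^ 2 / 2 := by
    -- Twice the variance is the mean squared distance of two independent samples, hence at most
    -- $D^2$.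
    have h1 : ∑ j, w j * ∑ i, w i * ‖(j : F) - i‖ ^ 2 = 2 * V w := by
      simp_rw [sum_mul_norm_sub_sq w hw.2 (fun i : T => (i : F))]
      simp only [mul_add, mul_sub, Finset.sum_add_distrib, Finset.sum_sub_distrib,
        ← Finset.sum_mul, hw.2, one_mul]
      have : ∑ x, w x * (2 * inner ℝ (x : F) c) = 2 * ‖c‖ ^ 2 := by
        rw [← real_inner_self_eq_norm_sq]
        conv_rhs => rw [hc, sum_inner, Finset.mul_sum]
        refine Finset.sum_congr rfl fun i _ => ?_
        rw [inner_smul_left]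
        simp only [conj_trivial]
        rw [← hc]
        ring
      rw [← hc, this]
      simp only [V, ← hc]
      ring
    have h2 : ∑ j, w j * ∑ i, w i * ‖(j : F) - i‖ ^ 2 ≤ D ^ 2 := by
      calc _ ≤ ∑ j, w j * ∑ i, w i * D ^ 2 := by
            refine Finset.sum_le_sum fun j _ => mul_le_mul_of_nonneg_left ?_ (hw.1 j)
            refine Finset.sum_le_sum fun i _ => mul_le_mul_of_nonneg_left ?_ (hw.1 i)
            exact pow_le_pow_left₀ (norm_nonneg _) (hD _ j.2 _ i.2) 2
        _ = D ^ 2 := by rw [← Finset.sum_mul, ← Finset.sum_mul, hw.2, one_mul, one_mul]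
    linarith
  refine ⟨c, ?_, fun t ht => ?_⟩
  · exact (convex_convexHull ℝ (T : Set F)).sum_mem (fun i _ => hw.1 i) hw.2
      fun i _ => subset_convexHull ℝ _ i.2
  -- First-order condition at the maximum: moving mass `s` to the point `t` cannot increase the
  -- variance. The bound on $\|t-c\|^2$ follows as $s\to0$.
  · have key : ∀ s ∈ Ioo (0 : ℝ) 1, (1 - s) * ‖t - c‖ ^ 2 ≤ V w := by
      intro s hs
      let w' : T → ℝ := (1 - s) • w + s • Pi.single ⟨t, ht⟩ 1
      have hw' : w' ∈ stdSimplex ℝ T := convex_stdSimplex ℝ T hw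
        (single_mem_stdSimplex ℝ _) (by linarith [hs.2]) hs.1.le (by ring)
      have h1 : V w' ≤ V w := hmax hw'
      have e1 : ∑ i, w' i • (i : F) = (1 - s) • c + s • t := by
        simp only [w', Pi.add_apply, Pi.smul_apply, smul_eq_mul, add_smul, Finset.sum_add_distrib,
          mul_smul, ← Finset.smul_sum, ← hc]
        congr 2
        rw [Finset.sum_eq_single ⟨t, ht⟩] <;> simp +contextual
      have e2 : ∑ i, w' i * ‖(i : F)‖ ^ 2 =
          (1 - s) * ∑ i, w i * ‖(i : F)‖ ^ 2 + s * ‖t‖ ^ 2 := by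
        simp only [w', Pi.add_apply, Pi.smul_apply, smul_eq_mul, add_mul, Finset.sum_add_distrib,
          mul_assoc, ← Finset.mul_sum]
        congr 2
        rw [Finset.sum_eq_single ⟨t, ht⟩] <;> simp +contextual
      have h3 : V w' = (1 - s) * V w + s * ((1 - s) * ‖t - c‖ ^ 2) := by
        simp only [V, e1, e2, norm_lineMap_sq, ← hc]
        ring
      have : s * ((1 - s) * ‖t - c‖ ^ 2) ≤ s * V w := by linarith
      exact le_of_mul_le_mul_left this hs.1
    have hlim : Tendsto (fun s : ℝ => (1 - s) * ‖t - c‖ ^ 2) (𝓝[>] 0) (𝓝 ((1 - 0) * ‖t - c‖ ^ 2)) :=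
      ((continuous_const.sub continuous_id).mul continuous_const).continuousAt.tendsto.mono_left
        nhdsWithin_le_nhds
    have := le_of_tendsto hlim (by
      filter_upwards [Ioo_mem_nhdsGT (zero_lt_one (α := ℝ))] with s hs using key s hs)
    linarith [this, hVw]

/-- The center of a finite set is at distance at most `3 / 4` of the diameter from its points, and
every ball which contains the set contains the center. -/
theorem exists_edist_center (T : Finset F) (hT : T.Nonempty) :
    ∃ c ∈ convexHull ℝ (T : Set F),
      (∀ D : ℝ≥0, (∀ s ∈ T, ∀ t ∈ T, edist s t ≤ D) →
        ∀ t ∈ T, edist t c ≤ (3 / 4 * D : ℝ≥0)) ∧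
      ∀ (z : F) (ρ : ℝ≥0), (∀ t ∈ T, edist z t ≤ ρ) → edist z c ≤ ρ := by
  obtain ⟨p, hp, hpmax⟩ := (T ×ˢ T).exists_max_image (fun p => ‖p.1 - p.2‖) (hT.product hT)
  obtain ⟨c, hc, h⟩ := exists_jung_center T hT ‖p.1 - p.2‖
    fun s hs t ht => hpmax (s, t) (Finset.mk_mem_product hs ht)
  refine ⟨c, hc, fun D hD t ht => ?_, fun z ρ hz => ?_⟩
  · have h1 := hD p.1 (Finset.mem_product.1 hp).1 p.2 (Finset.mem_product.1 hp).2
    rw [edist_nndist, ENNReal.coe_le_coe, ← NNReal.coe_le_coe, coe_nndist, dist_eq_norm] at h1 ⊢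
    have h2 := h t ht
    have h3 : ‖p.1 - p.2‖ ^ 2 ≤ (D : ℝ) ^ 2 := pow_le_pow_left₀ (norm_nonneg _) h1 2
    push_cast
    -- This uses $1/2\le(3/4)^2$.
    exact abs_le_of_sq_le_sq' (by nlinarith [sq_nonneg (D : ℝ)]) (by positivity) |>.2
  · have : (T : Set F) ⊆ Metric.closedBall z ρ := fun t ht => by
      have := hz t ht
      rwa [edist_comm, edist_nndist, ENNReal.coe_le_coe, ← NNReal.coe_le_coe, coe_nndist] at this
    have := convexHull_min this (convex_closedBall z ρ) hc
    rwa [edist_comm, edist_nndist, ENNReal.coe_le_coe, ← NNReal.coe_le_coe, coe_nndist]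

end Jung

/-- An `s`-bilipschitz parametrization of a set `U` by a convex subset of an inner product
space. -/
structure BilipschitzChart (X : Type*) [PseudoEMetricSpace X] (s : ℝ≥0) (U : Set X) where
  F : Type
  [normed : NormedAddCommGroup F]
  [inner : InnerProductSpace ℝ F]
  toFun : X → F
  invFun : F → X
  target : Set F
  convex : Convex ℝ target
  mapsTo : MapsTo toFun U target
  mapsTo_inv : MapsTo invFun target U
  right_inv : ∀ b ∈ target, toFun (invFun b) = b
  edist_le : ∀ x ∈ U, ∀ y ∈ U, edist (toFun x) (toFun y) ≤ s * edist x y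
  edist_ge : ∀ x ∈ U, ∀ y ∈ U, edist x y ≤ s * edist (toFun x) (toFun y)

attribute [instance] BilipschitzChart.normed BilipschitzChart.inner

/-- The center is taken in the chart and carried back; each estimate passes through the chart twice,
whence the factor $s^2$. Convexity of the target keeps the center in the domain of the inverse. -/
theorem BilipschitzChart.exists_center {X : Type*} [PseudoEMetricSpace X] {s : ℝ≥0} {U : Set X}
    (φ : BilipschitzChart X s U) (T : Finset X) (hT : T.Nonempty) (hTU : (T : Set X) ⊆ U) :
    ∃ c : X, (∀ D : ℝ≥0, (∀ x ∈ T, ∀ y ∈ T, edist x y ≤ D) →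
        ∀ t ∈ T, edist t c ≤ (s ^ 2 * (3 / 4) * D : ℝ≥0)) ∧
      ∀ z ∈ U, ∀ (ρ : ℝ≥0), (∀ t ∈ T, edist z t ≤ ρ) → edist z c ≤ (s ^ 2 * ρ : ℝ≥0) := by
  classical
  obtain ⟨c, hc, h1, h2⟩ := exists_edist_center (T.image φ.toFun) (hT.image _)
  have hct : c ∈ φ.target := by
    refine convexHull_min ?_ φ.convex hc
    rw [Finset.coe_image]
    exact (φ.mapsTo.mono_left hTU).image_subset
  have hle : ∀ x ∈ U, ∀ y ∈ U, ∀ D : ℝ≥0, edist x y ≤ D →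
      edist (φ.toFun x) (φ.toFun y) ≤ (s * D : ℝ≥0) := fun x hx y hy D h => by
    push_cast
    exact (φ.edist_le x hx y hy).trans (mul_le_mul_right h _)
  have hge : ∀ x ∈ U, ∀ D : ℝ≥0, edist (φ.toFun x) c ≤ D →
      edist x (φ.invFun c) ≤ (s * D : ℝ≥0) := fun x hx D h => by
    refine (φ.edist_ge x hx _ (φ.mapsTo_inv hct)).trans ?_
    rw [φ.right_inv c hct]
    push_cast
    exact mul_le_mul_right h _
  refine ⟨φ.invFun c, fun D hD t ht => ?_, fun z hz ρ hρ => ?_⟩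
  · have := hge t (hTU ht) _ (h1 (s * D) ?_ _ (Finset.mem_image_of_mem _ ht))
    · convert this using 2; ring
    · simp only [Finset.mem_image, forall_exists_index, and_imp, forall_apply_eq_imp_iff₂]
      exact fun x hx y hy => hle x (hTU hx) y (hTU hy) D (hD x hx y hy)
  · have := hge z hz _ (h2 (φ.toFun z) (s * ρ) ?_)
    · convert this using 2; ring
    · simp only [Finset.mem_image, forall_exists_index, and_imp, forall_apply_eq_imp_iff₂]
      exact fun x hx => hle z hz x (hTU hx) ρ (hρ x hx)

/-- A Lebesgue number of the cover puts each set of diameter below `r` in one chart domain. The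
constants fit because $(21/20)^4\cdot\frac34<\frac{15}{16}$. -/
theorem hasCenters_of_bilipschitzChart {X : Type*} [PseudoEMetricSpace X] [CompactSpace X]
    (h : ∀ x : X, ∃ U ∈ 𝓝 x, Nonempty (BilipschitzChart X (21 / 20) U)) :
    ∃ r : ℝ≥0, 0 < r ∧ (Nonempty X → HasCenters X r (15 / 16)) := by
  classical
  choose U hU φ using h
  obtain ⟨L, hL, hLU⟩ := lebesgue_number_lemma_of_emetric_nhds' (isCompact_univ (X := X))
    (fun x _ => hU x)
  obtain ⟨r, hr0, hrL⟩ := ENNReal.lt_iff_exists_nnreal_btwn.1 hL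
  refine ⟨r, by exact_mod_cast hr0, fun ⟨x₀⟩ => ?_⟩
  choose! p hp using fun x => hLU x (mem_univ x)
  have hc : ∀ T : Finset X, ∃ c : X, ∀ (D : ℝ≥0), T.Nonempty → D < r →
      (∀ s ∈ T, ∀ t ∈ T, edist s t ≤ D) →
      (∀ t ∈ T, edist t c ≤ ((21 / 20) ^ 2 * (3 / 4) * D : ℝ≥0)) ∧
      ∀ z, ∀ (ρ : ℝ≥0), ρ < r → (∀ t ∈ T, edist z t ≤ ρ) →
        edist z c ≤ ((21 / 20) ^ 2 * ρ : ℝ≥0) := by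
    intro T
    by_cases hT : ∃ t ∈ T, (T : Set X) ⊆ U (p t)
    · obtain ⟨t, ht, hTU⟩ := hT
      obtain ⟨c, h1, h2⟩ := (φ (p t)).some.exists_center T ⟨t, ht⟩ hTU
      refine ⟨c, fun D _ _ hTD => ⟨h1 D hTD, fun z ρ hρ hz => h2 z (hp t ?_) ρ hz⟩⟩
      exact (hz t ht).trans_lt (lt_trans (by exact_mod_cast hρ) hrL)
    · refine ⟨x₀, fun D ⟨t, ht⟩ hD hTD => (hT ⟨t, ht, fun s hs => hp t ?_⟩).elim⟩
      exact (hTD s hs t ht).trans_lt (lt_trans (by exact_mod_cast hD) hrL)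
  choose c hc using hc
  refine ⟨c, fun T D hT hD hTD => ?_⟩
  have h1 := (hc T D hT hD hTD).1
  -- Needed in order to use the ball property of the center of `T'` at this radius.
  have hlt : (21 / 20) ^ 2 * (3 / 4) * D < r := by
    rw [← NNReal.coe_lt_coe] at hD ⊢
    push_cast
    nlinarith [D.coe_nonneg]
  refine ⟨fun t ht => (h1 t ht).trans ?_, fun T' hT' hT'n => ?_⟩
  · rw [ENNReal.coe_le_coe, ← NNReal.coe_le_coe]
    push_cast
    nlinarith [D.coe_nonneg]
  -- The ball around `c T` that contains `T` contains `T'`, so up to another factor $(21/20)^2$ it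
  -- contains the center of `T'`.
  · rw [edist_comm]
    refine ((hc T' D hT'n hD fun s hs t ht => hTD s (hT' hs) t (hT' ht)).2 (c T) _ hlt
      fun t ht => ?_).trans ?_
    · rw [edist_comm]; exact h1 t (hT' ht)
    · rw [ENNReal.coe_le_coe, ← NNReal.coe_le_coe]
      push_cast
      nlinarith [D.coe_nonneg]

/-! ### Almost isometric charts of Riemannian manifolds. -/

section Riemannian

open Manifold Metric Bundle MeasureTheory

/-- In suitable linear coordinates on the fiber, the trivialization at `x` of a Riemannian vector
bundle distorts the norms near `x` by a factor arbitrarily close to `1`. -/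
theorem exists_linear_coordinates {B : Type*} [TopologicalSpace B] {F : Type*}
    [NormedAddCommGroup F] [NormedSpace ℝ F] [FiniteDimensional ℝ F] (E : B → Type*)
    [TopologicalSpace (TotalSpace F E)]
    [∀ x, NormedAddCommGroup (E x)] [∀ x, InnerProductSpace ℝ (E x)] [FiberBundle F E]
    [VectorBundle ℝ F E] [IsContinuousRiemannianBundle F E] (x : B) {r : ℝ} (hr : 1 < r) :
    ∃ (G : Type) (_ : NormedAddCommGroup G) (_ : InnerProductSpace ℝ G) (L : F ≃L[ℝ] G),
      ∀ᶠ y in 𝓝 x, (∀ v : E y,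
        ‖L ((trivializationAt F E x).continuousLinearMapAt ℝ y v)‖ ≤ r * ‖v‖) ∧
      ∀ w : F, ‖(trivializationAt F E x).symmL ℝ y w‖ ≤ r * ‖L w‖ := by
  have hx : x ∈ (trivializationAt F E x).baseSet := FiberBundle.mem_baseSet_trivializationAt' x
  let K := (trivializationAt F E x).continuousLinearEquivAt ℝ x hx
  have : FiniteDimensional ℝ (E x) := K.symm.toLinearEquiv.finiteDimensional
  let Φ := (stdOrthonormalBasis ℝ (E x)).repr
  -- With an orthonormal basis of the fiber at `x`, the coordinates are isometric at `x` itself;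
  -- continuity of the metric controls nearby fibers.
  have hL : ∀ w, ‖(K.symm.trans Φ.toContinuousLinearEquiv) w‖ =
      ‖(trivializationAt F E x).symmL ℝ x w‖ := fun w => by
    rw [ContinuousLinearEquiv.trans_apply]
    refine (Φ.norm_map (K.symm w)).trans ?_
    rw [Trivialization.symm_continuousLinearEquivAt_eq]
  refine ⟨_, inferInstance, inferInstance, K.symm.trans Φ.toContinuousLinearEquiv, ?_⟩
  filter_upwards [eventually_norm_symmL_trivializationAt_self_comp_lt F E x hr,
    eventually_norm_symmL_trivializationAt_comp_self_lt F E x hr] with y h1 h2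
  refine ⟨fun v => ?_, fun w => ?_⟩
  · rw [hL]
    exact (((trivializationAt F E x).symmL ℝ x ∘L
      (trivializationAt F E x).continuousLinearMapAt ℝ y).le_of_opNorm_le h1.le v)
  · rw [hL]
    have := (((trivializationAt F E x).symmL ℝ y ∘L
      (trivializationAt F E x).continuousLinearMapAt ℝ x).le_of_opNorm_le h2.le
        ((trivializationAt F E x).symmL ℝ x w))
    rwa [ContinuousLinearMap.comp_apply,
      Trivialization.continuousLinearMapAt_symmL _ hx] at this

attribute [local instance] normedAddCommGroupTangentSpaceVectorSpace
attribute [local instance] normedSpaceTangentSpaceVectorSpace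

variable {E : Type*} [NormedAddCommGroup E] [NormedSpace ℝ E]
    {H : Type*} [TopologicalSpace H] {I : ModelWithCorners ℝ E H}
    {M : Type*} [EMetricSpace M] [ChartedSpace H M] [IsManifold I 1 M]
    [RiemannianBundle (fun x : M => TangentSpace I x)]
    [IsRiemannianManifold I M] {G : Type*} [NormedAddCommGroup G] [NormedSpace ℝ G]

/-- Upper bound for the distance in a chart, in terms of the Riemannian distance. -/
theorem exists_nhds_edist_chart_le (x : M) (L : E →L[ℝ] G) {r : ℝ≥0}
    (h : ∀ᶠ y in 𝓝 x, ∀ v : TangentSpace I y,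
      ‖L (mfderiv% (extChartAt I x) y v)‖ₑ ≤ r * ‖v‖ₑ) :
    ∃ U ∈ 𝓝 x, ∀ y ∈ U, ∀ z ∈ U,
      edist (L (extChartAt I x y)) (L (extChartAt I x z)) ≤ r * edist y z := by
  obtain ⟨ε, hε, hball⟩ := EMetric.mem_nhds_iff.1
    (Filter.inter_mem h (chart_source_mem_nhds H x))
  -- A path shorter than $2\eta$ that starts within $\eta$ of `x` stays in the ball of radius
  -- $3\eta\le\epsilon$, where the derivative bound is available.
  obtain ⟨η, hη, hηε⟩ : ∃ η : ℝ≥0∞, 0 < η ∧ η + η + η ≤ ε :=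
    ⟨ε / 3, by simpa using hε.ne', (ENNReal.add_thirds ε).le⟩
  refine ⟨Metric.eball x η, Metric.eball_mem_nhds x hη, fun y hy z hz => ?_⟩
  -- A shortest path need not exist: paths of length less than `a` are used, and `a` then decreases
  -- to the distance.
  suffices H : ∀ a, edist y z < a → a ≤ η + η →
      edist (L (extChartAt I x y)) (L (extChartAt I x z)) ≤ r * a by
    have hlt : edist y z < η + η :=
      (edist_triangle_right y z x).trans_lt (ENNReal.add_lt_add hy hz)
    have : (𝓝[>] (edist y z)).NeBot := nhdsGT_neBot_of_exists_gt ⟨_, hlt⟩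
    refine ge_of_tendsto (f := fun a : ℝ≥0∞ => (r : ℝ≥0∞) * a) (x := 𝓝[>] (edist y z)) ?_ ?_
    · exact ENNReal.Tendsto.const_mul (tendsto_id.mono_left nhdsWithin_le_nhds)
        (Or.inr ENNReal.coe_ne_top)
    · filter_upwards [Ioo_mem_nhdsGT hlt] with a ha using H a ha.1 ha.2.le
  intro a ha haη
  rw [IsRiemannianManifold.out (I := I) y z] at ha
  obtain ⟨γ, hγ0, hγ1, γ_smooth, hγ, -⟩ :=
    exists_lt_locally_constant_of_riemannianEDist_lt ha zero_lt_one
  have hmem : ∀ t ∈ Icc (0 : ℝ) 1, γ t ∈ Metric.eball x ε := fun t ht => by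
    have h1 : edist y (γ t) ≤ pathELength I γ 0 1 := by
      rw [IsRiemannianManifold.out (I := I)]
      exact (riemannianEDist_le_pathELength γ_smooth.contMDiffOn hγ0 rfl ht.1).trans
        (pathELength_mono le_rfl ht.2)
    have h2 : edist (γ t) y < η + η := by
      rw [edist_comm]; exact (h1.trans_lt hγ).trans_le haη
    rw [Metric.mem_eball]
    calc edist (γ t) x ≤ edist (γ t) y + edist y x := edist_triangle _ _ _
      _ < η + η + η := ENNReal.add_lt_add h2 hy
      _ ≤ ε := hηε
  let γ₁ := extChartAt I x ∘ γ
  have hC : CMDiff[Icc (0 : ℝ) 1] 1 γ₁ :=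
    contMDiffOn_extChartAt.comp (I' := I) (t := (chartAt H x).source)
      γ_smooth.contMDiffOn (fun t ht ↦ (hball (hmem t ht)).2)
  rw [contMDiffOn_iff_contDiffOn] at hC
  let γ₂ := L ∘ γ₁
  have hC₂ : ContDiffOn ℝ 1 γ₂ (Icc 0 1) := L.contDiff.comp_contDiffOn hC
  calc edist (L (extChartAt I x y)) (L (extChartAt I x z)) = ‖γ₂ 1 - γ₂ 0‖ₑ := by
        rw [edist_comm, edist_eq_enorm_sub]; simp [γ₂, γ₁, hγ0, hγ1]
    _ ≤ ∫⁻ t in Icc 0 1, ‖derivWithin γ₂ (Icc 0 1) t‖ₑ :=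
        enorm_sub_le_lintegral_derivWithin_Icc_of_contDiffOn_Icc hC₂ zero_le_one
    _ ≤ ∫⁻ t in Icc 0 1, r * ‖mfderiv[Icc (0 : ℝ) 1] γ t 1‖ₑ := by
      apply setLIntegral_mono' measurableSet_Icc (fun t ht ↦ ?_)
      have hu : UniqueDiffWithinAt ℝ (Icc (0 : ℝ) 1) t := uniqueDiffOn_Icc zero_lt_one t ht
      have e1 : derivWithin γ₂ (Icc 0 1) t = L (fderivWithin ℝ γ₁ (Icc 0 1) t 1) := by
        rw [← fderivWithin_derivWithin]
        exact L.hasFDerivAt.comp_hasDerivWithinAt t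
          ((hC.differentiableOn one_ne_zero t ht).hasDerivWithinAt) |>.derivWithin hu
      have e2 : mfderiv[Icc (0 : ℝ) 1] γ₁ t =
          (mfderiv% (extChartAt I x) (γ t)) ∘L (mfderiv[Icc (0 : ℝ) 1] γ t) := by
        apply mfderiv_comp_mfderivWithin
        · exact mdifferentiableAt_extChartAt (hball (hmem t ht)).2
        · exact (γ_smooth.mdifferentiable one_ne_zero).mdifferentiableOn _ ht
        · rwa [uniqueMDiffWithinAt_iff_uniqueDiffWithinAt]
      have e3 : fderivWithin ℝ γ₁ (Icc 0 1) t 1 =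
          (mfderiv% (extChartAt I x) (γ t)) (mfderiv[Icc (0 : ℝ) 1] γ t 1) := by
        rw [← mfderivWithin_eq_fderivWithin]
        exact congr($e2 1)
      rw [e1, e3]
      exact (hball (hmem t ht)).1 _
    _ = r * pathELength I γ 0 1 := by
      rw [lintegral_const_mul' _ _ ENNReal.coe_ne_top, pathELength_eq_lintegral_mfderivWithin_Icc]
    _ ≤ r * a := mul_le_mul_right hγ.le _

/-- Upper bound for the Riemannian distance, in terms of the distance in a chart. -/
theorem edist_symm_le_edist_chart (x : M) (L : E →L[ℝ] G) {r : ℝ≥0} {s : Set E} (hs : Convex ℝ s)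
    (hst : s ⊆ (extChartAt I x).target)
    (h : ∀ b ∈ s, ∀ v : E, ‖(mfderiv[range I] (extChartAt I x).symm b v)‖ₑ ≤ r * ‖L v‖ₑ)
    {a b : E} (ha : a ∈ s) (hb : b ∈ s) :
    edist ((extChartAt I x).symm a) ((extChartAt I x).symm b) ≤ r * edist (L a) (L b) := by
  let η := ContinuousAffineMap.lineMap (R := ℝ) a b
  set γ := (extChartAt I x).symm ∘ η
  have hη : Icc 0 1 ⊆ ⇑η ⁻¹' s := by
    simp only [← image_subset_iff, ContinuousAffineMap.coe_lineMap_eq,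
     ← segment_eq_image_lineMap, η]
    exact hs.segment_subset ha hb
  have hη' : Icc 0 1 ⊆ ⇑η ⁻¹' (extChartAt I x).target := hη.trans (preimage_mono hst)
  have η_smooth : CMDiff[Icc (0 : ℝ) 1] 1 η := by
    apply ContMDiff.contMDiffOn
    rw [contMDiff_iff_contDiff]
    exact ContinuousAffineMap.contDiff _
  have : edist ((extChartAt I x).symm a) ((extChartAt I x).symm b) ≤ pathELength I γ 0 1 := by
    rw [IsRiemannianManifold.out (I := I)]
    apply riemannianEDist_le_pathELength _ _ _ zero_le_one
    · exact (contMDiffOn_extChartAt_symm x).comp η_smooth hη'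
    · simp [γ, η, ContinuousAffineMap.coe_lineMap_eq]
    · simp [γ, η, ContinuousAffineMap.coe_lineMap_eq]
  refine this.trans ?_
  have hLab : edist (L a) (L b) = ∫⁻ t in Icc (0 : ℝ) 1, ‖L (b - a)‖ₑ := by
    simp [edist_comm (L a), edist_eq_enorm_sub]
  rw [hLab, pathELength_eq_lintegral_mfderivWithin_Icc,
    ← lintegral_const_mul' _ _ ENNReal.coe_ne_top]
  apply setLIntegral_mono' measurableSet_Icc (fun t ht ↦ ?_)
  have hu : UniqueDiffWithinAt ℝ (Icc (0 : ℝ) 1) t := uniqueDiffOn_Icc zero_lt_one t ht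
  have e1 : mfderiv[Icc (0 : ℝ) 1] γ t =
      (mfderiv[range I] (extChartAt I x).symm (η t)) ∘L (mfderiv[Icc (0 : ℝ) 1] η t) := by
    apply mfderivWithin_comp
    · exact mdifferentiableWithinAt_extChartAt_symm (hη' ht)
    · exact η_smooth.mdifferentiableOn one_ne_zero t ht
    · exact hη'.trans (preimage_mono (extChartAt_target_subset_range x))
    · rwa [uniqueMDiffWithinAt_iff_uniqueDiffWithinAt]
  have e2 : (mfderiv[Icc (0 : ℝ) 1] η t) 1 = b - a := by
    rw [mfderivWithin_eq_fderivWithin]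
    have : HasDerivWithinAt η (b - a) (Icc 0 1) t := by
      simpa [η, ContinuousAffineMap.coe_lineMap_eq] using
        (AffineMap.hasDerivAt_lineMap (a := a) (b := b) (x := t)).hasDerivWithinAt
    change fderivWithin ℝ η (Icc 0 1) t 1 = b - a
    rw [← this.derivWithin hu, fderivWithin_derivWithin]
  have e3 : mfderiv[Icc (0 : ℝ) 1] γ t 1 =
      (mfderiv[range I] (extChartAt I x).symm (η t)) (mfderiv[Icc (0 : ℝ) 1] η t 1) := congr($e1 1)
  rw [e3, e2]
  exact h _ (hη ht) _

theorem exists_bilipschitzChart {E : Type*} [NormedAddCommGroup E] [NormedSpace ℝ E]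
    [FiniteDimensional ℝ E] {H : Type*} [TopologicalSpace H] (I : ModelWithCorners ℝ E H)
    {M : Type*} [EMetricSpace M] [ChartedSpace H M] [IsManifold I 1 M]
    [RiemannianBundle (fun x : M => TangentSpace I x)]
    [IsContinuousRiemannianBundle E (fun x : M => TangentSpace I x)]
    [IsRiemannianManifold I M] (x : M) {r : ℝ≥0} (hr : 1 < r) :
    ∃ U ∈ 𝓝 x, Nonempty (BilipschitzChart M r U) := by
  obtain ⟨G, _, _, L, hL⟩ := exists_linear_coordinates (F := E) (fun x : M => TangentSpace I x) x
    (r := r) (by exact_mod_cast hr)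
  have hsrc := chart_source_mem_nhds H x
  have h1 : ∀ᶠ y in 𝓝 x, ∀ v : TangentSpace I y,
      ‖(L : E →L[ℝ] G) (mfderiv% (extChartAt I x) y v)‖ₑ ≤ r * ‖v‖ₑ := by
    filter_upwards [hL, hsrc] with y hy hy' v
    have := hy.1 v
    rw [TangentBundle.continuousLinearMapAt_trivializationAt hy'] at this
    simp only [enorm, ← ENNReal.coe_mul, ENNReal.coe_le_coe]
    exact_mod_cast this
  obtain ⟨U, hU, hUle⟩ := exists_nhds_edist_chart_le (I := I) x (L : E →L[ℝ] G) h1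
  have h2 : ∀ᶠ y in 𝓝 x, y ∈ (chartAt H x).source ∧
      ∀ w : E, ‖(trivializationAt E (fun x : M => TangentSpace I x) x).symmL ℝ y w‖ ≤ r * ‖L w‖ := by
    filter_upwards [hL, hsrc] with y hy hy' using ⟨hy', hy.2⟩
  rw [show 𝓝 x = 𝓝 ((extChartAt I x).symm (extChartAt I x x)) by simp] at h2
  have h3 := nhdsWithin_le_nhds (s := range I)
    ((continuousAt_extChartAt_symm (I := I) x).preimage_mem_nhds h2)
  have h4 := nhdsWithin_le_nhds (s := range I)
    ((continuousAt_extChartAt_symm (I := I) x).preimage_mem_nhds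
      (show U ∈ 𝓝 ((extChartAt I x).symm (extChartAt I x x)) by simpa using hU))
  obtain ⟨ρ, ρ_pos, hρ⟩ := Metric.mem_nhdsWithin_iff.1
    (inter_mem (inter_mem h3 h4) (extChartAt_target_mem_nhdsWithin x))
  -- A single convex set on which the derivative bound holds and whose image lies in `U`.
  set s := ball (extChartAt I x x) ρ ∩ range I with hs
  have hconv : Convex ℝ s := (convex_ball _ _).inter I.convex_range
  have hst : s ⊆ (extChartAt I x).target := fun b hb => (hρ hb).2
  have hder : ∀ b ∈ s, ∀ v : E, ‖(mfderiv[range I] (extChartAt I x).symm b v)‖ₑ ≤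
      r * ‖(L : E →L[ℝ] G) v‖ₑ := by
    intro b hb v
    have hy : (extChartAt I x).symm b ∈ (chartAt H x).source := (hρ hb).1.1.1
    have := (hρ hb).1.1.2 v
    rw [TangentBundle.symmL_trivializationAt hy] at this
    have hb' : extChartAt I x ((extChartAt I x).symm b) = b :=
      (extChartAt I x).right_inv (hst hb)
    rw [hb'] at this
    simp only [enorm, ← ENNReal.coe_mul, ENNReal.coe_le_coe]
    exact_mod_cast this
  have A : (extChartAt I x) ⁻¹' s ∈ 𝓝 x := by
    apply extChartAt_preimage_mem_nhds_of_mem_nhdsWithin (by simp)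
    rw [hs, inter_comm]
    exact inter_mem_nhdsWithin _ (ball_mem_nhds _ ρ_pos)
  refine ⟨(extChartAt I x) ⁻¹' s ∩ (chartAt H x).source, inter_mem A hsrc, ⟨{
    F := G
    toFun := fun y => L (extChartAt I x y)
    invFun := fun b => (extChartAt I x).symm (L.symm b)
    target := L '' s
    convex := hconv.linear_image L.toLinearEquiv.toLinearMap
    mapsTo := fun y hy => mem_image_of_mem _ hy.1
    mapsTo_inv := ?_
    right_inv := ?_
    edist_le := ?_
    edist_ge := ?_ }⟩⟩
  · rintro _ ⟨b, hb, rfl⟩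
    beta_reduce
    rw [L.symm_apply_apply]
    refine ⟨?_, (hρ hb).1.1.1⟩
    rw [mem_preimage, (extChartAt I x).right_inv (hst hb)]
    exact hb
  · rintro _ ⟨b, hb, rfl⟩
    rw [L.symm_apply_apply, (extChartAt I x).right_inv (hst hb)]
  · have hmem : ∀ y ∈ (extChartAt I x) ⁻¹' s ∩ (chartAt H x).source, y ∈ U := fun y hy => by
      have := (hρ hy.1).1.2
      rwa [mem_preimage, (extChartAt I x).left_inv (by simpa using hy.2)] at this
    exact fun y hy z hz => hUle y (hmem y hy) z (hmem z hz)
  · intro y hy z hz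
    have := edist_symm_le_edist_chart (I := I) x (L : E →L[ℝ] G) hconv hst hder hy.1 hz.1
    rwa [(extChartAt I x).left_inv (by simpa using hy.2),
      (extChartAt I x).left_inv (by simpa using hz.2)] at this

end Riemannian

/-- A compact Riemannian manifold has centers at all small scales. -/
theorem exists_hasCenters_of_isRiemannianManifold {d : ℕ} {M : Type*} [EMetricSpace M]
    [CompactSpace M]
    [ChartedSpace (EuclideanSpace ℝ (Fin d)) M] [IsManifold (𝓡 d) ∞ M]
    [Bundle.RiemannianBundle (fun x : M => TangentSpace (𝓡 d) x)]
    [IsContMDiffRiemannianBundle (𝓡 d) ∞ (EuclideanSpace ℝ (Fin d))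
      (fun x : M => TangentSpace (𝓡 d) x)]
    [IsRiemannianManifold (𝓡 d) M] :
    ∃ r : ℝ≥0, 0 < r ∧ (Nonempty M → HasCenters M r (15 / 16)) := by
  have : IsManifold (𝓡 d) 1 M := IsManifold.of_le (n := ∞) (by norm_num)
  have : IsContinuousRiemannianBundle (EuclideanSpace ℝ (Fin d))
      (fun x : M => TangentSpace (𝓡 d) x) := by
    obtain ⟨g, hg, h⟩ := IsContMDiffRiemannianBundle.exists_contMDiff (IB := 𝓡 d) (n := ∞)
      (F := EuclideanSpace ℝ (Fin d)) (E := fun x : M => TangentSpace (𝓡 d) x)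
    exact ⟨g, hg.continuous, h⟩
  refine hasCenters_of_bilipschitzChart fun x => exists_bilipschitzChart (𝓡 d) x ?_
  rw [← NNReal.coe_lt_coe]
  norm_num

/-! ### Faces, coordinates and heights in the standard simplex. -/

/-- The standard simplex of dimension `n`. -/
abbrev Simplex (n : ℕ) : Type := stdSimplex ℝ (Fin (n + 1))

namespace Simplex

variable {n : ℕ}

/-- The `i`-th face inclusion. -/
def face (i : Fin (n + 2)) : Simplex n → Simplex (n + 1) := stdSimplex.map i.succAbove

@[simp]
theorem face_succAbove (i : Fin (n + 2)) (x : Simplex n) (j : Fin (n + 1)) :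
    face i x (i.succAbove j) = x j := by
  simp only [face, stdSimplex.map_coe]
  rw [FunOnFinite.linearMap_apply_apply, Finset.sum_eq_single j] <;>
    simp +contextual

@[simp]
theorem face_self (i : Fin (n + 2)) (x : Simplex n) : face i x i = 0 := by
  simp only [face, stdSimplex.map_coe]
  rw [FunOnFinite.linearMap_apply_apply]
  simp [Finset.filter_false_of_mem, Fin.succAbove_ne]

theorem continuous_face (i : Fin (n + 2)) : Continuous (face i : Simplex n → _) :=
  stdSimplex.continuous_map _

theorem exists_face_eq (i : Fin (n + 2)) (y : Simplex (n + 1)) (h : y i = 0) :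
    ∃ x : Simplex n, face i x = y := by
  refine ⟨⟨fun j => y (i.succAbove j), fun j => y.2.1 _, ?_⟩, ?_⟩
  · have := stdSimplex.sum_eq_one y
    rwa [Fin.sum_univ_succAbove _ i, h, zero_add] at this
  · ext j
    rcases Fin.eq_self_or_eq_succAbove i j with rfl | ⟨j, rfl⟩
    · rw [face_self, h]
    · rw [face_succAbove]; rfl

theorem continuous_coord (j : Fin (n + 1)) : Continuous fun x : Simplex n => x j :=
  (continuous_apply j).comp continuous_subtype_val

theorem dist_eq (x y : Simplex n) : dist x y = dist (⇑x) (⇑y) := rfl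

theorem dist_coord_le (x y : Simplex n) (j : Fin (n + 1)) : dist (x j) (y j) ≤ dist x y :=
  dist_le_pi_dist (⇑x) (⇑y) j

theorem dist_face (i : Fin (n + 2)) (x y : Simplex n) : dist (face i x) (face i y) = dist x y := by
  refine le_antisymm ?_ ?_
  · rw [dist_eq, dist_pi_le_iff dist_nonneg]
    intro j
    rcases Fin.eq_self_or_eq_succAbove i j with rfl | ⟨j, rfl⟩
    · simp
    · simpa using dist_coord_le x y j
  · rw [dist_eq, dist_pi_le_iff dist_nonneg]
    intro j
    simpa using dist_coord_le (face i x) (face i y) (i.succAbove j)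

theorem isometry_face (i : Fin (n + 2)) : Isometry (face i : Simplex n → _) :=
  Isometry.of_dist_eq (dist_face i)

/-- The largest barycentric coordinate. -/
def height (x : Simplex n) : ℝ := Finset.univ.sup' Finset.univ_nonempty x

theorem coord_le_height (x : Simplex n) (j : Fin (n + 1)) : x j ≤ x.height :=
  Finset.le_sup' (⇑x) (Finset.mem_univ j)

theorem exists_coord_eq_height (x : Simplex n) : ∃ j, x j = x.height := by
  obtain ⟨j, -, h⟩ := Finset.exists_mem_eq_sup' Finset.univ_nonempty (⇑x)
  exact ⟨j, h.symm⟩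

theorem height_pos (x : Simplex n) : 0 < x.height := by
  by_contra h
  have : ∑ j, x j ≤ 0 := Finset.sum_nonpos fun j _ => (coord_le_height x j).trans (not_lt.1 h)
  rw [stdSimplex.sum_eq_one] at this
  linarith

theorem height_face (i : Fin (n + 2)) (x : Simplex n) : (face i x).height = x.height := by
  refine le_antisymm (Finset.sup'_le _ _ fun j _ => ?_) (Finset.sup'_le _ _ fun j _ => ?_)
  · rcases Fin.eq_self_or_eq_succAbove i j with rfl | ⟨j, rfl⟩
    · rw [face_self]; exact x.height_pos.le
    · rw [face_succAbove]; exact coord_le_height x j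
  · rw [← face_succAbove i x j]; exact coord_le_height _ _

theorem continuous_height : Continuous (height : Simplex n → ℝ) :=
  Continuous.finset_sup'_apply _ fun j _ => continuous_coord j

/-! ### Grid points and weights compatible with faces. -/

section Grid

/-- The points of the simplex whose coordinates are multiples of `1 / N`. -/
def gridSet (N n : ℕ) : Set (Simplex n) := {w | ∀ j, ∃ k : ℕ, w j = k / N}

theorem finite_gridSet {N : ℕ} (hN : 0 < N) (n : ℕ) : (gridSet N n).Finite := by
  have hN' : (0 : ℝ) < N := by exact_mod_cast hN
  have : (Set.pi univ fun _ : Fin (n + 1) => (fun k : ℕ => (k : ℝ) / N) '' Iic N).Finite :=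
    Set.Finite.pi fun _ => (finite_Iic N).image _
  refine Set.Finite.of_finite_image (f := fun w : Simplex n => (⇑w : Fin (n + 1) → ℝ))
    (this.subset ?_) DFunLike.coe_injective.injOn
  rintro _ ⟨w, hw, rfl⟩ j -
  obtain ⟨k, hk⟩ := hw j
  refine ⟨k, ?_, hk.symm⟩
  have := stdSimplex.le_one w j
  rw [hk, div_le_one hN'] at this
  exact_mod_cast this

open Classical in
/-- The finite set of grid points; it is empty if `N = 0`. -/
def grid (N n : ℕ) : Finset (Simplex n) :=
  if hN : 0 < N then (finite_gridSet hN n).toFinset else ∅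

theorem mem_grid {N : ℕ} (hN : 0 < N) (w : Simplex n) : w ∈ grid N n ↔ w ∈ gridSet N n := by
  simp [grid, hN]

theorem face_mem_grid {N : ℕ} (i : Fin (n + 2)) (w : Simplex n) :
    face i w ∈ grid N (n + 1) ↔ w ∈ grid N n := by
  rcases Nat.eq_zero_or_pos N with rfl | hN
  · simp [grid]
  rw [mem_grid hN, mem_grid hN]
  refine ⟨fun h j => by simpa using h (i.succAbove j), fun h j => ?_⟩
  rcases Fin.eq_self_or_eq_succAbove i j with rfl | ⟨j, rfl⟩
  · exact ⟨0, by simp⟩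
  · simpa using h j

/-- Every point is close to a grid point of the same face. -/
theorem exists_mem_grid {N : ℕ} (hN : 0 < N) (x : Simplex n) :
    ∃ w ∈ grid N n, dist x w ≤ 1 / N ∧ ∀ j, w j ≠ 0 → 0 < x j := by
  have hN' : (0 : ℝ) < N := by exact_mod_cast hN
  let y : ℕ → ℝ := fun k => if h : k < n + 1 then x ⟨k, h⟩ else 0
  have hy : ∀ j : Fin (n + 1), y j = x j := fun j => dif_pos j.2
  have hy0 : ∀ k, 0 ≤ y k := fun k => by
    simp only [y]
    split_ifs <;> simp
  let s : ℕ → ℝ := fun k => ∑ l ∈ Finset.range k, y l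
  have hs : ∀ k, s (k + 1) = s k + y k := fun k => Finset.sum_range_succ _ _
  have hs0 : ∀ k, 0 ≤ s k := fun k => Finset.sum_nonneg fun _ _ => hy0 _
  -- Rounding the partial sums, rather than the coordinates, keeps the total equal to 1. Differences
  -- of consecutive values are the new coordinates, and they vanish where those of `x` do.
  let f : ℕ → ℕ := fun k => ⌊N * s k⌋₊
  have hf : ∀ k, f k ≤ f (k + 1) := fun k => Nat.floor_mono
    (mul_le_mul_of_nonneg_left (by linarith [hs k, hy0 k]) hN'.le)
  have hle : ∀ k, (f k : ℝ) ≤ N * s k := fun k => Nat.floor_le (mul_nonneg hN'.le (hs0 k))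
  have hlt : ∀ k, N * s k < f k + 1 := fun k => Nat.lt_floor_add_one _
  have hsum : ∑ j : Fin (n + 1), (((f (j + 1) - f j : ℕ) : ℝ) / N) = 1 := by
    rw [← Finset.sum_div, div_eq_one_iff_eq hN'.ne',
      Fin.sum_univ_eq_sum_range (fun j => ((f (j + 1) - f j : ℕ) : ℝ))]
    have : ∀ j, ((f (j + 1) - f j : ℕ) : ℝ) = f (j + 1) - f j := fun j => by
      rw [Nat.cast_sub (hf j)]
    simp_rw [this]
    rw [Finset.sum_range_sub (fun j => (f j : ℝ))]
    have h1 : s (n + 1) = 1 := by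
      rw [← stdSimplex.sum_eq_one x]
      simp only [s]
      rw [← Fin.sum_univ_eq_sum_range]
      exact Finset.sum_congr rfl fun j _ => hy j
    simp [f, h1, s]
  let w : Simplex n := ⟨fun j => ((f (j + 1) - f j : ℕ) : ℝ) / N, fun j => by positivity, hsum⟩
  have hw : ∀ j : Fin (n + 1), w j = ((f (j + 1) : ℝ) - f j) / N := fun j => by
    rw [← Nat.cast_sub (hf j)]; rfl
  refine ⟨w, (mem_grid hN w).2 fun j => ⟨_, rfl⟩, ?_, fun j hj => ?_⟩
  · rw [dist_eq, dist_pi_le_iff (by positivity)]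
    intro j
    have e : x j - w j = (N * x j - ((f (j + 1) : ℝ) - f j)) / N := by
      rw [hw]; field_simp
    have h1 : N * x j = N * s (j + 1) - N * s j := by rw [hs, hy]; ring
    rw [Real.dist_eq, e, abs_div, abs_of_pos hN']
    refine div_le_div_of_nonneg_right (abs_le.2 ⟨?_, ?_⟩) hN'.le <;>
      linarith [hle j, hlt j, hle (j + 1), hlt (j + 1)]
  · rw [← hy]
    refine (hy0 j).lt_of_ne' fun h => hj ?_
    rw [hw]
    simp only [f]
    rw [hs, h, add_zero, sub_self, zero_div]

/-- The weight of the point `w` at the point `x`: it is positive if `x` is at distance less than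
`ρ` of `w`, and does not lie in a face which does not contain `w`. -/
def weight (ρ : ℝ) (w x : Simplex n) : ℝ :=
  (∏ j, if w j = 0 then 1 else x j) * max 0 (ρ - dist x w)

theorem weight_nonneg (ρ : ℝ) (w x : Simplex n) : 0 ≤ weight ρ w x :=
  mul_nonneg (Finset.prod_nonneg fun j _ => by split_ifs <;> simp) (le_max_left _ _)

theorem weight_face (ρ : ℝ) (i : Fin (n + 2)) (w x : Simplex n) :
    weight ρ (face i w) (face i x) = weight ρ w x := by
  simp [weight, dist_face, Fin.prod_univ_succAbove _ i]

theorem weight_eq_zero_of_face (ρ : ℝ) (i : Fin (n + 2)) (w : Simplex (n + 1)) (x : Simplex n)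
    (h : w i ≠ 0) : weight ρ w (face i x) = 0 := by
  rw [weight, Finset.prod_eq_zero (Finset.mem_univ i), zero_mul]
  simp [h]

theorem continuous_weight (ρ : ℝ) (w : Simplex n) : Continuous (weight ρ w) := by
  refine (continuous_finsetProd _ fun j _ => ?_).mul (by fun_prop)
  split_ifs
  · exact continuous_const
  · exact continuous_coord j

theorem dist_lt_of_weight_pos {ρ : ℝ} {w x : Simplex n} (h : 0 < weight ρ w x) : dist x w < ρ := by
  by_contra hd
  rw [weight, max_eq_left (by linarith), mul_zero] at h
  exact h.false

theorem weight_pos {ρ : ℝ} {w x : Simplex n} (h : dist x w < ρ) (h' : ∀ j, w j ≠ 0 → 0 < x j) :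
    0 < weight ρ w x := by
  refine mul_pos (Finset.prod_pos fun j _ => ?_) (lt_max_of_lt_right (by linarith))
  split_ifs with hj
  · exact one_pos
  · exact h' j hj

end Grid

/-- The threshold depends on the set `S` only, which makes the choice of heavy grid points
compatible with faces. Its distance to `S` is bounded below in terms of the maximum and the
cardinality, which makes the choice stable under small perturbations. -/
theorem exists_gap (S : Finset ℝ) : ∃ θ : ℝ, ∀ M ∈ S, 0 < M → (∀ s ∈ S, s ≤ M) →
    0 < θ ∧ θ + M / (2 * (S.card + 2)) ≤ M ∧ ∀ s ∈ S, M / (2 * (S.card + 2)) ≤ |s - θ| := by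
  by_cases hS : ∃ M ∈ S, 0 < M ∧ ∀ s ∈ S, s ≤ M
  swap
  · exact ⟨0, fun M hM h0 h => (hS ⟨M, hM, h0, h⟩).elim⟩
  obtain ⟨M, hM, h0, hmax⟩ := hS
  set m := S.card with hm
  set g : ℝ := M / (2 * (m + 2)) with hg
  have hgpos : 0 < g := by positivity
  have hMg : M = 2 * (m + 2) * g := by rw [hg]; field_simp
  -- Pigeonhole: the intervals of radius `g` around the `m + 1` candidates are disjoint, so one of
  -- them misses the `m` elements of `S`. The largest candidate is $M-2g$.
  obtain ⟨j, hj, hgap⟩ : ∃ j ∈ Finset.range (m + 1), ∀ s ∈ S, g ≤ |s - 2 * (j + 1) * g| := by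
    by_contra! hcon
    choose! f hfS hf using hcon
    have : (Finset.range (m + 1)).card ≤ S.card := by
      refine Finset.card_le_card_of_injOn f hfS fun j hj k hk hjk => ?_
      have h1 := abs_lt.1 (hf j hj)
      have h2 := abs_lt.1 (hf k hk)
      rw [hjk] at h1
      have h3 : (j : ℝ) < k + 1 := by nlinarith
      have h4 : (k : ℝ) < j + 1 := by nlinarith
      have h3' : j < k + 1 := by exact_mod_cast h3
      have h4' : k < j + 1 := by exact_mod_cast h4
      omega
    rw [Finset.card_range] at this
    omega
  have hj' : (j : ℝ) ≤ m := by
    have := Finset.mem_range.1 hj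
    exact_mod_cast Nat.lt_succ_iff.1 this
  refine ⟨2 * (j + 1) * g, fun M' hM' _ hmax' => ?_⟩
  obtain rfl : M' = M := le_antisymm (hmax _ hM') (hmax' _ hM)
  rw [← hg]
  exact ⟨mul_pos (by positivity) hgpos, by nlinarith, hgap⟩

/-- A canonical real number which is away from all the points of a finite set. -/
def gapPoint (S : Finset ℝ) : ℝ := (exists_gap S).choose

/-! ### Heavy and heaviest grid points. -/

section Approximation

open Classical in
/-- The values at `x` of the weights of the grid points, and zero. -/
def weightValues (N : ℕ) (x : Simplex n) : Finset ℝ :=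
  insert 0 ((grid N n).image fun w => weight (2 / N) w x)

open Classical in
/-- The grid points whose weight at `x` is above a canonical threshold. -/
def heavyPoints (N : ℕ) (x : Simplex n) : Finset (Simplex n) :=
  (grid N n).filter fun w => gapPoint (weightValues N x) < weight (2 / N) w x

open Classical in
/-- The grid points with the largest weight at `x`. -/
def heaviestPoints (N : ℕ) (x : Simplex n) : Finset (Simplex n) :=
  (grid N n).filter fun w => ∀ s ∈ weightValues N x, s ≤ weight (2 / N) w x

theorem weight_mem_weightValues {N : ℕ} {w : Simplex n} (hw : w ∈ grid N n) (x : Simplex n) :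
    weight (2 / N) w x ∈ weightValues N x :=
  Finset.mem_insert_of_mem (Finset.mem_image_of_mem _ hw)

theorem exists_weight_pos {N : ℕ} (hN : 0 < N) (x : Simplex n) :
    ∃ w ∈ grid N n, 0 < weight (2 / N) w x := by
  have hN' : (0 : ℝ) < N := by exact_mod_cast hN
  obtain ⟨w, hw, hd, hs⟩ := exists_mem_grid hN x
  -- The cutoff radius $2/N$ exceeds the rounding error $1/N$.
  exact ⟨w, hw, weight_pos (hd.trans_lt (by gcongr; norm_num)) hs⟩

theorem exists_heaviest {N : ℕ} (hN : 0 < N) (x : Simplex n) :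
    ∃ w ∈ grid N n, 0 < weight (2 / N) w x ∧
      ∀ s ∈ weightValues N x, s ≤ weight (2 / N) w x := by
  obtain ⟨w₀, hw₀, h₀⟩ := exists_weight_pos hN x
  obtain ⟨w, hw, h⟩ := (grid N n).exists_max_image (fun w => weight (2 / N) w x) ⟨w₀, hw₀⟩
  refine ⟨w, hw, h₀.trans_le (h _ hw₀), fun s hs => ?_⟩
  rcases Finset.mem_insert.1 hs with rfl | hs
  · exact weight_nonneg _ _ _
  · obtain ⟨v, hv, rfl⟩ := Finset.mem_image.1 hs
    exact h v hv

theorem mem_heaviestPoints_iff {N : ℕ} {w x : Simplex n} : w ∈ heaviestPoints N x ↔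
    w ∈ grid N n ∧ ∀ s ∈ weightValues N x, s ≤ weight (2 / N) w x := by
  simp [heaviestPoints]

theorem mem_heavyPoints_iff {N : ℕ} {w x : Simplex n} : w ∈ heavyPoints N x ↔
    w ∈ grid N n ∧ gapPoint (weightValues N x) < weight (2 / N) w x := by
  simp [heavyPoints]

theorem heaviestPoints_nonempty {N : ℕ} (hN : 0 < N) (x : Simplex n) :
    (heaviestPoints N x).Nonempty := by
  obtain ⟨w, hw, -, h⟩ := exists_heaviest hN x
  exact ⟨w, mem_heaviestPoints_iff.2 ⟨hw, h⟩⟩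

theorem weight_pos_of_mem_heaviestPoints {N : ℕ} (hN : 0 < N) {w x : Simplex n}
    (h : w ∈ heaviestPoints N x) : 0 < weight (2 / N) w x := by
  obtain ⟨v, hv, h0, -⟩ := exists_heaviest hN x
  exact h0.trans_le ((mem_heaviestPoints_iff.1 h).2 _ (weight_mem_weightValues hv x))

theorem gapPoint_spec {N : ℕ} (hN : 0 < N) {w x : Simplex n} (h : w ∈ heaviestPoints N x) :
    0 < gapPoint (weightValues N x) ∧
    gapPoint (weightValues N x) + weight (2 / N) w x / (2 * ((weightValues N x).card + 2)) ≤
      weight (2 / N) w x ∧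
    ∀ s ∈ weightValues N x, weight (2 / N) w x / (2 * ((weightValues N x).card + 2)) ≤
      |s - gapPoint (weightValues N x)| :=
  (exists_gap (weightValues N x)).choose_spec _
    (weight_mem_weightValues (mem_heaviestPoints_iff.1 h).1 x)
    (weight_pos_of_mem_heaviestPoints hN h) (mem_heaviestPoints_iff.1 h).2

theorem dist_lt_of_mem_heaviestPoints {N : ℕ} (hN : 0 < N) {w x : Simplex n}
    (h : w ∈ heaviestPoints N x) : dist x w < 2 / N :=
  dist_lt_of_weight_pos (weight_pos_of_mem_heaviestPoints hN h)

theorem dist_lt_of_mem_heavyPoints {N : ℕ} (hN : 0 < N) {w x : Simplex n}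
    (h : w ∈ heavyPoints N x) : dist x w < 2 / N := by
  obtain ⟨v, hv⟩ := heaviestPoints_nonempty hN x
  exact dist_lt_of_weight_pos ((gapPoint_spec hN hv).1.trans (mem_heavyPoints_iff.1 h).2)

/-- For nearby points, the sets of heavy points are nested, and contain the sets of heaviest
points. -/
theorem exists_heavyPoints_nested {N : ℕ} (hN : 0 < N) (n : ℕ) :
    ∃ δ > 0, ∀ x y : Simplex n, dist x y < δ → heaviestPoints N x ⊆ heavyPoints N y ∧
      (heavyPoints N x ⊆ heavyPoints N y ∨ heavyPoints N y ⊆ heavyPoints N x) := by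
  classical
  obtain ⟨x₀⟩ : Nonempty (Simplex n) := inferInstance
  have hne : (grid N n).Nonempty := (exists_weight_pos hN x₀).imp fun w hw => hw.1
  let M : Simplex n → ℝ := fun x => (grid N n).sup' hne fun w => weight (2 / N) w x
  have hMcont : Continuous M :=
    Continuous.finset_sup'_apply _ fun w _ => continuous_weight _ _
  have hMeq : ∀ {w x : Simplex n}, w ∈ heaviestPoints N x → weight (2 / N) w x = M x :=
    fun {w x} hw => le_antisymm
      (Finset.le_sup' (fun w => weight (2 / N) w x) (mem_heaviestPoints_iff.1 hw).1)
      (Finset.sup'_le _ _ fun v hv =>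
        (mem_heaviestPoints_iff.1 hw).2 _ (weight_mem_weightValues hv x))
  obtain ⟨z, -, hz⟩ := (isCompact_univ (X := Simplex n)).exists_isMinOn univ_nonempty
    hMcont.continuousOn
  have hMz : 0 < M z := by
    obtain ⟨w, hw⟩ := heaviestPoints_nonempty hN z
    rw [← hMeq hw]
    exact weight_pos_of_mem_heaviestPoints hN hw
  -- A lower bound, uniform in the point, for the gaps around the thresholds: `M z` is the least
  -- maximal weight, and there are at most `card + 1` values because of the inserted zero.
  set g : ℝ := M z / (2 * (((grid N n).card + 1) + 2)) with hg
  have hgpos : 0 < g := by positivity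
  have hgle : ∀ x : Simplex n, g ≤ M x / (2 * ((weightValues N x).card + 2)) := fun x => by
    have h1 : M z ≤ M x := hz (mem_univ x)
    have h2 : ((weightValues N x).card : ℝ) ≤ (grid N n).card + 1 := by
      exact_mod_cast (Finset.card_insert_le _ _).trans (Nat.succ_le_succ Finset.card_image_le)
    have h3 : 0 ≤ M x := (hMz.trans_le h1).le
    rw [hg]
    gcongr
  have hunif : ∀ w ∈ grid N n, ∃ δ > 0, ∀ x y : Simplex n, dist x y < δ →
      |weight (2 / N) w x - weight (2 / N) w y| < g / 2 := fun w _ => by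
    obtain ⟨δ, hδ, h⟩ := Metric.uniformContinuous_iff.1
      (CompactSpace.uniformContinuous_of_continuous (continuous_weight (2 / N) w))
      (g / 2) (half_pos hgpos)
    exact ⟨δ, hδ, fun x y hxy => h hxy⟩
  choose! δ hδ hδ' using hunif
  obtain ⟨η, hη, hηδ⟩ : ∃ η > 0, ∀ w ∈ grid N n, η ≤ δ w := by
    refine ⟨(grid N n).inf' hne δ, (Finset.lt_inf'_iff _).2 hδ, fun w hw => Finset.inf'_le _ hw⟩
  refine ⟨η, hη, fun x y hxy => ?_⟩
  have hclose : ∀ w ∈ grid N n, |weight (2 / N) w x - weight (2 / N) w y| < g / 2 :=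
    fun w hw => hδ' w hw x y (hxy.trans_le (hηδ w hw))
  obtain ⟨a, ha⟩ := heaviestPoints_nonempty hN x
  obtain ⟨b, hb⟩ := heaviestPoints_nonempty hN y
  have hax := gapPoint_spec hN ha
  have hby := gapPoint_spec hN hb
  rw [hMeq ha] at hax
  rw [hMeq hb] at hby
  set θx := gapPoint (weightValues N x)
  set θy := gapPoint (weightValues N y)
  -- From `x` to `y` the weights change by less than the gap, so none crosses the threshold of `x`.
  have hx' : ∀ w ∈ grid N n, (θx < weight (2 / N) w x ↔ θx < weight (2 / N) w y) := by
    intro w hw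
    have h1 := abs_lt.1 (hclose w hw)
    have h2 := (hgle x).trans (hax.2.2 _ (weight_mem_weightValues hw x))
    rcases le_abs.1 h2 with h2 | h2 <;> constructor <;> intro h3 <;> linarith
  refine ⟨fun w hw => ?_, ?_⟩
  -- A heaviest point at `x` has at `y` a weight within `g` of the maximum, while the threshold at
  -- `y` lies at least `g` below that maximum.
  · have hwg := (mem_heaviestPoints_iff.1 hw).1
    refine mem_heavyPoints_iff.2 ⟨hwg, ?_⟩
    have h1 := abs_lt.1 (hclose w hwg)
    have h2 := hMeq hw
    have hbg := (mem_heaviestPoints_iff.1 hb).1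
    have h3 := abs_lt.1 (hclose b hbg)
    have h4 := hMeq hb
    have h5 := (mem_heaviestPoints_iff.1 hw).2 _ (weight_mem_weightValues hbg x)
    have h6 := hgle y
    change θy < _
    linarith [hby.2.1]
  -- Both heavy sets are superlevel sets of the same function, the weights at `y`, for the
  -- thresholds `θx` and `θy`; hence they are nested.
  · rcases le_total θx θy with h | h
    · refine Or.inr fun w hw => ?_
      rw [mem_heavyPoints_iff] at hw ⊢
      exact ⟨hw.1, (hx' w hw.1).2 (h.trans_lt hw.2)⟩
    · refine Or.inl fun w hw => ?_
      rw [mem_heavyPoints_iff] at hw ⊢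
      exact ⟨hw.1, h.trans_lt ((hx' w hw.1).1 hw.2)⟩

theorem heaviestPoints_subset {N : ℕ} (hN : 0 < N) (x : Simplex n) :
    heaviestPoints N x ⊆ heavyPoints N x := by
  obtain ⟨δ, hδ, h⟩ := exists_heavyPoints_nested hN n
  exact (h x x (by simpa using hδ)).1

/-- Grid points outside the face have weight zero there. They add nothing to the set of values,
since zero was inserted from the start. -/
theorem weightValues_face (N : ℕ) (i : Fin (n + 2)) (x : Simplex n) :
    weightValues N (face i x) = weightValues N x := by
  classical
  ext s
  simp only [weightValues, Finset.mem_insert, Finset.mem_image]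
  constructor
  · rintro (h | ⟨w, hw, rfl⟩)
    · exact Or.inl h
    · by_cases hwi : w i = 0
      · obtain ⟨v, rfl⟩ := exists_face_eq i w hwi
        exact Or.inr ⟨v, (face_mem_grid i v).1 hw, (weight_face _ i v x).symm⟩
      · exact Or.inl (weight_eq_zero_of_face _ i w x hwi)
  · rintro (h | ⟨w, hw, rfl⟩)
    · exact Or.inl h
    · exact Or.inr ⟨face i w, (face_mem_grid i w).2 hw, weight_face _ i w x⟩

open Classical in
theorem heavyPoints_face {N : ℕ} (hN : 0 < N) (i : Fin (n + 2)) (x : Simplex n) :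
    heavyPoints N (face i x) = (heavyPoints N x).image (face i) := by
  ext w
  rw [mem_heavyPoints_iff, weightValues_face, Finset.mem_image]
  constructor
  · rintro ⟨hw, h⟩
    by_cases hwi : w i = 0
    · obtain ⟨v, rfl⟩ := exists_face_eq i w hwi
      rw [weight_face] at h
      exact ⟨v, mem_heavyPoints_iff.2 ⟨(face_mem_grid i v).1 hw, h⟩, rfl⟩
    · rw [weight_eq_zero_of_face _ i w x hwi] at h
      obtain ⟨v, hv⟩ := heaviestPoints_nonempty hN x
      exact absurd h (gapPoint_spec hN hv).1.not_gt
  · rintro ⟨v, hv, rfl⟩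
    rw [weight_face, face_mem_grid]
    exact mem_heavyPoints_iff.1 hv

open Classical in
theorem heaviestPoints_face {N : ℕ} (hN : 0 < N) (i : Fin (n + 2)) (x : Simplex n) :
    heaviestPoints N (face i x) = (heaviestPoints N x).image (face i) := by
  ext w
  rw [Finset.mem_image]
  constructor
  · intro h
    have h0 := weight_pos_of_mem_heaviestPoints hN h
    rw [mem_heaviestPoints_iff, weightValues_face] at h
    by_cases hwi : w i = 0
    · obtain ⟨v, rfl⟩ := exists_face_eq i w hwi
      rw [weight_face] at h
      exact ⟨v, mem_heaviestPoints_iff.2 ⟨(face_mem_grid i v).1 h.1, h.2⟩, rfl⟩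
    · rw [weight_eq_zero_of_face _ i w x hwi] at h0
      exact absurd h0 (lt_irrefl _)
  · rintro ⟨v, hv, rfl⟩
    rw [mem_heaviestPoints_iff, weightValues_face, weight_face, face_mem_grid]
    exact mem_heaviestPoints_iff.1 hv

end Approximation

end Simplex

/-! ### Jumps of maps at small scales. -/

section Fine

variable {Y X : Type*} [PseudoEMetricSpace Y] [PseudoEMetricSpace X]

/-- At small scales, the jumps of `f`, the jumps of `g`, and the jumps from `f` to `g` are at most
`D`. -/
def CloseMaps (D : ℝ≥0) (f g : Y → X) : Prop :=
  ∃ δ : ℝ≥0, 0 < δ ∧ ∀ y z, edist y z < δ →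
    edist (f y) (f z) ≤ D ∧ edist (f y) (g z) ≤ D ∧ edist (g y) (g z) ≤ D

/-- At small scales, the jumps of `f` are at most `D`. -/
def FineMap (D : ℝ≥0) (f : Y → X) : Prop :=
  ∃ δ : ℝ≥0, 0 < δ ∧ ∀ y z, edist y z < δ → edist (f y) (f z) ≤ D

theorem epsContinuous_iff {ε : ℝ} {f : Y → X} :
    EpsContinuous ε f ↔ ∃ D : ℝ≥0, (D : ℝ≥0∞) < ENNReal.ofReal ε ∧ FineMap D f := by
  constructor
  · rintro ⟨δ, hδ, h⟩
    obtain ⟨D, hD⟩ := ENNReal.lt_iff_exists_nnreal_btwn.1 h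
    refine ⟨D, hD.2, δ.toNNReal, Real.toNNReal_pos.2 hδ, fun y z hyz => le_trans ?_ hD.1.le⟩
    exact le_iSup_of_le y (le_iSup_of_le z (le_iSup_of_le hyz le_rfl))
  · rintro ⟨D, hD, δ, hδ, h⟩
    refine ⟨δ, hδ, lt_of_le_of_lt (iSup_le fun y => iSup_le fun z => iSup_le fun hyz => ?_) hD⟩
    rw [ENNReal.ofReal_coe_nnreal] at hyz
    exact h y z hyz

theorem FineMap.mono {D D' : ℝ≥0} {f : Y → X} (hf : FineMap D f) (h : D ≤ D') : FineMap D' f := by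
  obtain ⟨δ, hδ, h'⟩ := hf
  exact ⟨δ, hδ, fun y z hyz => (h' y z hyz).trans (by exact_mod_cast h)⟩

/-- Gluing: locally, with uniform size `δ`, the map coincides with one of two $\epsilon$-continuous
maps. -/
theorem epsContinuous_of_forall_eventually_eq {ε : ℝ} {f g₁ g₂ : Y → X}
    (h₁ : EpsContinuous ε g₁) (h₂ : EpsContinuous ε g₂) (δ : ℝ≥0) (hδ : 0 < δ)
    (h : ∀ y z, edist y z < δ → (f y = g₁ y ∧ f z = g₁ z) ∨ (f y = g₂ y ∧ f z = g₂ z)) :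
    EpsContinuous ε f := by
  rw [epsContinuous_iff] at *
  obtain ⟨D₁, hD₁, δ₁, hδ₁, H₁⟩ := h₁
  obtain ⟨D₂, hD₂, δ₂, hδ₂, H₂⟩ := h₂
  refine ⟨max D₁ D₂, ?_, min δ (min δ₁ δ₂), lt_min hδ (lt_min hδ₁ hδ₂), fun y z hyz => ?_⟩
  · rcases max_cases D₁ D₂ with h | h <;> rw [h.1] <;> assumption
  · have l₁ : ((min δ (min δ₁ δ₂) : ℝ≥0) : ℝ≥0∞) ≤ δ := by exact_mod_cast min_le_left _ _
    have l₂ : ((min δ (min δ₁ δ₂) : ℝ≥0) : ℝ≥0∞) ≤ δ₁ := by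
      exact_mod_cast (min_le_right _ _).trans (min_le_left _ _)
    have l₃ : ((min δ (min δ₁ δ₂) : ℝ≥0) : ℝ≥0∞) ≤ δ₂ := by
      exact_mod_cast (min_le_right _ _).trans (min_le_right _ _)
    rcases h y z (hyz.trans_le l₁) with ⟨e₁, e₂⟩ | ⟨e₁, e₂⟩ <;> rw [e₁, e₂]
    · exact (H₁ y z (hyz.trans_le l₂)).trans (by exact_mod_cast le_max_left _ _)
    · exact (H₂ y z (hyz.trans_le l₃)).trans (by exact_mod_cast le_max_right _ _)

end Fine

/-! ### Face-natural homotopies, possibly discontinuous in time. -/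

section Homotopy

variable {X : Type*}

/-- Compatibility of an operation on maps from simplices with the restriction to faces. -/
def FaceNatural (F : ∀ n : ℕ, (Simplex n → X) → Simplex n → X) : Prop :=
  ∀ n (i : Fin (n + 2)) (σ : Simplex (n + 1) → X) (x : Simplex n),
    F n (σ ∘ Simplex.face i) x = F (n + 1) σ (Simplex.face i x)

variable [PseudoEMetricSpace X]

/-- The conditions for a family `H` of maps `Δⁿ × ℝ → X` to be a homotopy of operations on maps
from simplices to `X`: it is natural with respect to faces and, for the maps in `W`, it is
`ε`-continuous, and even continuous if the map is continuous. -/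
structure IsOpHomotopy (ε : ℝ) (W : Set (Σ n, Simplex n → X))
    (F G : ∀ n : ℕ, (Simplex n → X) → Simplex n → X)
    (H : ∀ n : ℕ, (Simplex n → X) → Simplex n × ℝ → X) : Prop where
  natural : ∀ n (i : Fin (n + 2)) (σ : Simplex (n + 1) → X) (x : Simplex n) (t : ℝ),
    H n (σ ∘ Simplex.face i) (x, t) = H (n + 1) σ (Simplex.face i x, t)
  left : ∀ n σ x t, t ≤ 0 → H n σ (x, t) = F n σ x
  right : ∀ n σ x t, 1 ≤ t → H n σ (x, t) = G n σ x
  eps : ∀ p ∈ W, EpsContinuous ε (H p.1 p.2)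
  cont : ∀ p ∈ W, Continuous p.2 → Continuous (H p.1 p.2)

/-- Two operations on maps from simplices to `X` are homotopic. -/
def OpHomotopic (ε : ℝ) (W : Set (Σ n, Simplex n → X))
    (F G : ∀ n : ℕ, (Simplex n → X) → Simplex n → X) : Prop :=
  ∃ H, IsOpHomotopy ε W F G H

variable {ε : ℝ} {W : Set (Σ n, Simplex n → X)}
    {F G K : ∀ n : ℕ, (Simplex n → X) → Simplex n → X}

theorem uniformContinuous_affine_snd {Y : Type*} [UniformSpace Y] (a b : ℝ) :
    UniformContinuous fun p : Y × ℝ => (p.1, a * p.2 + b) :=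
  uniformContinuous_fst.prodMk
    (((uniformContinuous_const_smul a).comp uniformContinuous_snd).add uniformContinuous_const)

/-- The two homotopies run at triple speed, with a pause at `G` for times between $1/3$ and $2/3$.
During the pause both formulas are valid, so every ball of radius $1/6$ in time sees only one of
them. -/
theorem OpHomotopic.trans (h₁ : OpHomotopic ε W F G) (h₂ : OpHomotopic ε W G K) :
    OpHomotopic ε W F K := by
  obtain ⟨H₁, h₁⟩ := h₁
  obtain ⟨H₂, h₂⟩ := h₂
  have e₁ : ∀ n σ (p : Simplex n × ℝ), p.2 < 2 / 3 →
      (if p.2 ≤ 1 / 2 then H₁ n σ (p.1, 3 * p.2 + 0) else H₂ n σ (p.1, 3 * p.2 + -2)) =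
        H₁ n σ (p.1, 3 * p.2 + 0) := fun n σ p hp => by
    split_ifs with h
    · rfl
    · rw [h₁.right _ _ _ _ (by linarith), h₂.left _ _ _ _ (by linarith)]
  have e₂ : ∀ n σ (p : Simplex n × ℝ), 1 / 3 < p.2 →
      (if p.2 ≤ 1 / 2 then H₁ n σ (p.1, 3 * p.2 + 0) else H₂ n σ (p.1, 3 * p.2 + -2)) =
        H₂ n σ (p.1, 3 * p.2 + -2) := fun n σ p hp => by
    split_ifs with h
    · rw [h₁.right _ _ _ _ (by linarith), h₂.left _ _ _ _ (by linarith)]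
    · rfl
  refine ⟨fun n σ p => if p.2 ≤ 1 / 2 then H₁ n σ (p.1, 3 * p.2 + 0)
    else H₂ n σ (p.1, 3 * p.2 + -2), ⟨fun n i σ x t => ?_, fun n σ x t ht => ?_,
      fun n σ x t ht => ?_, fun p hp => ?_, fun p hp hc => ?_⟩⟩
  · simp only [h₁.natural, h₂.natural]
  · rw [e₁ _ _ _ (by dsimp only; linarith)]
    exact h₁.left _ _ _ _ (by dsimp only; linarith)
  · rw [e₂ _ _ _ (by dsimp only; linarith)]
    exact h₂.right _ _ _ _ (by dsimp only; linarith)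
  · refine epsContinuous_of_forall_eventually_eq
      ((h₁.eps p hp).comp_uniformContinuous (uniformContinuous_affine_snd 3 0))
      ((h₂.eps p hp).comp_uniformContinuous (uniformContinuous_affine_snd 3 (-2)))
      (1 / 6) (by positivity) fun y z hyz => ?_
    have hd : dist y.2 z.2 < 1 / 6 := by
      have : edist y.2 z.2 < ((1 / 6 : ℝ≥0) : ℝ≥0∞) :=
        (le_max_right (edist y.1 z.1) _).trans_lt hyz
      rw [edist_nndist, ENNReal.coe_lt_coe, ← NNReal.coe_lt_coe] at this
      simpa using this
    rw [Real.dist_eq, abs_lt] at hd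
    rcases le_total y.2 (1 / 2) with h | h
    · exact Or.inl ⟨e₁ _ _ _ (by linarith), e₁ _ _ _ (by linarith)⟩
    · exact Or.inr ⟨e₂ _ _ _ (by linarith), e₂ _ _ _ (by linarith)⟩
  · rw [continuous_iff_continuousAt]
    intro q
    rcases lt_or_ge q.2 (2 / 3) with h | h
    · refine ContinuousAt.congr (f := fun q => H₁ p.1 p.2 (q.1, 3 * q.2 + 0)) ?_ ?_
      · exact ((h₁.cont p hp hc).comp (by fun_prop)).continuousAt
      · filter_upwards [continuous_snd.continuousAt.eventually (gt_mem_nhds h)] with q hq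
        exact (e₁ _ _ _ hq).symm
    · refine ContinuousAt.congr (f := fun q => H₂ p.1 p.2 (q.1, 3 * q.2 + -2)) ?_ ?_
      · exact ((h₂.cont p hp hc).comp (by fun_prop)).continuousAt
      · filter_upwards [continuous_snd.continuousAt.eventually
          (lt_mem_nhds (a := 1 / 3) (by linarith))] with q hq
        exact (e₂ _ _ _ hq).symm

/-- A homotopy which jumps. -/
theorem OpHomotopic.of_closeMaps (hF : FaceNatural F) (hG : FaceNatural G)
    (h : ∀ p ∈ W, ∃ D : ℝ≥0, (D : ℝ≥0∞) < ENNReal.ofReal ε ∧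
      CloseMaps D (F p.1 p.2) (G p.1 p.2))
    (hc : ∀ p ∈ W, Continuous p.2 → G p.1 p.2 = F p.1 p.2 ∧ Continuous (F p.1 p.2)) :
    OpHomotopic ε W F G := by
  -- The homotopy switches from `F` to `G` at time $1/2$; the closeness of the two maps bounds the
  -- jump.
  refine ⟨fun n σ p => if p.2 ≤ 1 / 2 then F n σ p.1 else G n σ p.1,
    ⟨fun n i σ x t => ?_, fun n σ x t ht => ?_,
      fun n σ x t ht => ?_, fun p hp => ?_, fun p hp hpc => ?_⟩⟩
  · simp only [hF n i σ x, hG n i σ x]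
  · exact if_pos (by dsimp only; linarith)
  · exact if_neg (by dsimp only; linarith)
  · obtain ⟨D, hD, δ, hδ, H⟩ := h p hp
    refine epsContinuous_iff.2 ⟨D, hD, δ, hδ, fun y z hyz => ?_⟩
    have hy : edist y.1 z.1 < δ := (le_max_left _ (edist y.2 z.2)).trans_lt hyz
    have h1 := H y.1 z.1 hy
    have h2 := H z.1 y.1 (by rwa [edist_comm])
    dsimp only
    split_ifs
    · exact h1.1
    · exact h1.2.1
    · rw [edist_comm]; exact h2.2.1
    · exact h1.2.2
  · obtain ⟨e, hc⟩ := hc p hp hpc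
    simp only [e, ite_self]
    exact hc.comp continuous_fst

end Homotopy

/-! ### Collapsing neighbourhoods of faces. -/

namespace Simplex

variable {n : ℕ}

theorem sum_collapse_pos (a : ℝ) (ha : a < 1) (x : Simplex n) :
    0 < ∑ j, max (x j - a * x.height) 0 := by
  obtain ⟨j, hj⟩ := x.exists_coord_eq_height
  refine Finset.sum_pos' (fun j _ => le_max_right _ _) ⟨j, Finset.mem_univ j, ?_⟩
  rw [hj]
  exact lt_max_of_lt_left (by nlinarith [x.height_pos])

/-- Half of the projection of `t` to the unit interval. -/
def halfClamp (t : ℝ) : ℝ := max 0 (min t 1) / 2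

theorem halfClamp_lt_one (t : ℝ) : halfClamp t < 1 := by
  have : max 0 (min t 1) ≤ 1 := max_le zero_le_one (min_le_right _ _)
  rw [halfClamp]; linarith

theorem halfClamp_of_nonpos {t : ℝ} (ht : t ≤ 0) : halfClamp t = 0 := by
  rw [halfClamp, max_eq_left ((min_le_left _ _).trans ht), zero_div]

theorem halfClamp_of_one_le {t : ℝ} (ht : 1 ≤ t) : halfClamp t = 1 / 2 := by
  rw [halfClamp, min_eq_right ht, max_eq_right zero_le_one]

theorem continuous_halfClamp : Continuous halfClamp := by
  unfold halfClamp
  fun_prop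

/-- The map which collapses the points which are close to a face to this face. The parameter is
the time of a homotopy from the identity. -/
def collapse (p : Simplex n × ℝ) : Simplex n :=
  ⟨fun j => max (p.1 j - halfClamp p.2 * p.1.height) 0 /
    ∑ k, max (p.1 k - halfClamp p.2 * p.1.height) 0,
    fun _ => div_nonneg (le_max_right _ _) (sum_collapse_pos _ (halfClamp_lt_one _) _).le, by
      rw [← Finset.sum_div, div_self (sum_collapse_pos _ (halfClamp_lt_one _) _).ne']⟩

theorem collapse_apply (p : Simplex n × ℝ) (j : Fin (n + 1)) :
    collapse p j = max (p.1 j - halfClamp p.2 * p.1.height) 0 /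
      ∑ k, max (p.1 k - halfClamp p.2 * p.1.height) 0 := rfl

theorem collapse_of_nonpos (x : Simplex n) {t : ℝ} (ht : t ≤ 0) : collapse (x, t) = x := by
  ext j
  simp [collapse_apply, halfClamp_of_nonpos ht]

theorem collapse_of_one_le (x : Simplex n) {t : ℝ} (ht : 1 ≤ t) :
    collapse (x, t) = collapse (x, 1) := by
  ext j
  simp [collapse_apply, halfClamp_of_one_le ht, halfClamp_of_one_le le_rfl]

theorem halfClamp_nonneg (t : ℝ) : 0 ≤ halfClamp t :=
  div_nonneg (le_max_left _ _) zero_le_two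

theorem collapse_eq_zero (x : Simplex n) (j : Fin (n + 1)) (h : x j ≤ 1 / 2 * x.height) :
    collapse (x, 1) j = 0 := by
  rw [collapse_apply, halfClamp_of_one_le le_rfl, max_eq_right (by dsimp only; linarith), zero_div]

theorem collapse_face (i : Fin (n + 2)) (x : Simplex n) (t : ℝ) :
    collapse (face i x, t) = face i (collapse (x, t)) := by
  have h0 : max (0 - halfClamp t * x.height) 0 = 0 :=
    max_eq_right (by nlinarith [halfClamp_nonneg t, x.height_pos])
  ext j
  rcases Fin.eq_self_or_eq_succAbove i j with rfl | ⟨j, rfl⟩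
  · rw [face_self, collapse_apply]
    simp only [face_self, height_face, h0, zero_div]
  · rw [face_succAbove, collapse_apply, collapse_apply, Fin.sum_univ_succAbove _ i]
    simp only [face_succAbove, face_self, height_face, h0, zero_add]

theorem continuous_collapse : Continuous (collapse : Simplex n × ℝ → Simplex n) := by
  have h : ∀ j, Continuous fun p : Simplex n × ℝ =>
      max (p.1 j - halfClamp p.2 * p.1.height) 0 := fun j =>
    ((((continuous_coord j).comp continuous_fst).sub
      ((continuous_halfClamp.comp continuous_snd).mul
        (continuous_height.comp continuous_fst)))).max continuous_const
  refine Continuous.subtype_mk (continuous_pi fun j => ?_) _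
  exact (h j).div (continuous_finsetSum _ fun k _ => h k)
    fun p => (sum_collapse_pos _ (halfClamp_lt_one _) _).ne'

/-- The time enters only through its projection to the unit interval, so the map factors through a
compact space. -/
theorem uniformContinuous_collapse :
    UniformContinuous (collapse : Simplex n × ℝ → Simplex n) := by
  have h : (collapse : Simplex n × ℝ → Simplex n) =
      (fun q : Simplex n × Icc (0 : ℝ) 1 => collapse (q.1, (q.2 : ℝ))) ∘
        Prod.map id (projIcc 0 1 zero_le_one) := by
    ext p j
    have : halfClamp (projIcc (0 : ℝ) 1 zero_le_one p.2 : ℝ) = halfClamp p.2 := by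
      simp only [halfClamp, coe_projIcc]
      rw [min_comm p.2 1]
      congr 1
      rw [min_eq_left (max_le zero_le_one (min_le_left _ _)), max_eq_right (le_max_left _ _)]
    simp only [Function.comp_apply, collapse_apply, Prod.map_fst, Prod.map_snd, this, id]
  rw [h]
  refine (CompactSpace.uniformContinuous_of_continuous
    (continuous_collapse.comp (by fun_prop))).comp
    (uniformContinuous_id.prodMap ((LipschitzWith.projIcc zero_le_one).uniformContinuous))

end Simplex

/-- The operation on maps from simplices which makes them constant in the directions normal to the
faces, near the faces. -/
def collapseOp {X : Type*} (n : ℕ) (σ : Simplex n → X) (x : Simplex n) : X :=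
  σ (Simplex.collapse (x, 1))

theorem faceNatural_collapseOp {X : Type*} : FaceNatural (X := X) collapseOp := fun n i σ x => by
  simp only [collapseOp, Function.comp_apply, Simplex.collapse_face]

theorem opHomotopic_collapseOp {X : Type*} [PseudoEMetricSpace X] {ε : ℝ}
    {W : Set (Σ n, Simplex n → X)} (hW : ∀ p ∈ W, EpsContinuous ε p.2) :
    OpHomotopic ε W (fun _ σ => σ) collapseOp :=
  ⟨fun _ σ p => σ (Simplex.collapse p),
    fun n i σ x t => by simp only [Function.comp_apply, Simplex.collapse_face],
    fun n σ x t ht => by simp only [Simplex.collapse_of_nonpos x ht],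
    fun n σ x t ht => by simp only [Simplex.collapse_of_one_le x ht, collapseOp],
    fun p hp => (hW p hp).comp_uniformContinuous Simplex.uniformContinuous_collapse,
    fun p _ hc => hc.comp Simplex.continuous_collapse⟩

/-! ### Points close to faces of continuity. -/

section Tame

variable {n : ℕ} {X : Type*}

namespace Simplex

/-- The face of the standard simplex spanned by a set of vertices. -/
def faceSet (G : Finset (Fin (n + 1))) : Set (Simplex n) := {x | ∀ j ∉ G, x j = 0}

open Classical in
theorem image_faceSet (i : Fin (n + 2)) (G : Finset (Fin (n + 1))) :
    face i '' faceSet G = faceSet (G.image i.succAbove) := by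
  ext y
  constructor
  · rintro ⟨x, hx, rfl⟩ j hj
    rcases Fin.eq_self_or_eq_succAbove i j with rfl | ⟨j, rfl⟩
    · exact face_self _ _
    · rw [face_succAbove]
      exact hx j fun h => hj (Finset.mem_image_of_mem _ h)
  · intro hy
    obtain ⟨x, rfl⟩ := exists_face_eq i y (hy i fun h => by
      obtain ⟨j, -, hj⟩ := Finset.mem_image.1 h
      exact Fin.succAbove_ne i j hj)
    refine ⟨x, fun j hj => ?_, rfl⟩
    rw [← face_succAbove i x j]
    refine hy _ fun h => hj ?_
    obtain ⟨k, hk, e⟩ := Finset.mem_image.1 h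
    rwa [← Fin.succAbove_right_injective e]

end Simplex

open Simplex

variable [TopologicalSpace X]

/-- The points which are close to a face on which `σ` is continuous. -/
def tameSet (a : ℝ) (σ : Simplex n → X) : Set (Simplex n) :=
  {x | ∃ G, ContinuousOn σ (faceSet G) ∧ ∀ j ∉ G, x j ≤ a * x.height}

theorem tameSet_of_continuous (a : ℝ) {σ : Simplex n → X} (h : Continuous σ) :
    tameSet a σ = univ :=
  eq_univ_of_forall fun _ => ⟨Finset.univ, h.continuousOn, fun j hj => (hj (Finset.mem_univ j)).elim⟩

/-- A discontinuous simplex can have continuous faces, and naturality fixes the values there.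
Tameness therefore refers to all faces of continuity, and must be intrinsic to each face. -/
theorem face_mem_tameSet {a : ℝ} (ha : 0 ≤ a) (i : Fin (n + 2)) (σ : Simplex (n + 1) → X)
    (x : Simplex n) : face i x ∈ tameSet a σ ↔ x ∈ tameSet a (σ ∘ face i) := by
  classical
  constructor
  · rintro ⟨G, hG, hx⟩
    refine ⟨Finset.univ.filter fun j => i.succAbove j ∈ G, ?_, fun j hj => ?_⟩
    · refine hG.comp (continuous_face i).continuousOn fun y hy j hj => ?_
      rcases Fin.eq_self_or_eq_succAbove i j with rfl | ⟨j, rfl⟩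
      · exact face_self _ _
      · rw [face_succAbove]
        exact hy j (by simpa using hj)
    · rw [← face_succAbove i x j, ← height_face i x]
      exact hx _ (by simpa using hj)
  · rintro ⟨G, hG, hx⟩
    refine ⟨G.image i.succAbove, ?_, fun j hj => ?_⟩
    · rw [← image_faceSet]
      exact (isometry_face i).isUniformInducing.isInducing.continuousOn_image_iff.2 hG
    · rw [height_face]
      rcases Fin.eq_self_or_eq_succAbove i j with rfl | ⟨j, rfl⟩
      · rw [face_self]
        exact mul_nonneg ha x.height_pos.le
      · rw [face_succAbove]
        exact hx j fun h => hj (Finset.mem_image_of_mem _ h)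

theorem isClosed_tameSet (a : ℝ) (σ : Simplex n → X) : IsClosed (tameSet a σ) := by
  have : tameSet a σ = ⋃ G ∈ {G | ContinuousOn σ (faceSet G)},
      {x | ∀ j ∉ G, x j ≤ a * x.height} := by
    ext x
    simp [tameSet]
  rw [this]
  refine (Set.toFinite _).isClosed_biUnion fun G _ => ?_
  simp only [ofPred_forall]
  exact isClosed_iInter fun j => isClosed_iInter fun _ =>
    isClosed_le (continuous_coord j) (continuous_const.mul continuous_height)

theorem tameSet_mono {a b : ℝ} (h : a ≤ b) (σ : Simplex n → X) : tameSet a σ ⊆ tameSet b σ :=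
  fun x ⟨G, hG, hx⟩ => ⟨G, hG, fun j hj => (hx j hj).trans
    (mul_le_mul_of_nonneg_right h x.height_pos.le)⟩

theorem isOpen_lt_height (b : ℝ) (G : Finset (Fin (n + 1))) :
    IsOpen {y : Simplex n | ∀ j ∉ G, y j < b * y.height} := by
  simp only [ofPred_forall]
  exact isOpen_iInter_of_finite fun j => isOpen_iInter_of_finite fun _ =>
    isOpen_lt (continuous_coord j) (continuous_const.mul continuous_height)

theorem tameSet_mem_nhds {a b : ℝ} (h : a < b) {σ : Simplex n → X} {x : Simplex n}
    (hx : x ∈ tameSet a σ) : tameSet b σ ∈ 𝓝 x := by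
  obtain ⟨G, hG, hx⟩ := hx
  refine mem_of_superset ((isOpen_lt_height b G).mem_nhds fun j hj => ?_)
    fun y hy => ⟨G, hG, fun j hj => (hy j hj).le⟩
  exact (hx j hj).trans_lt (mul_lt_mul_of_pos_right h x.height_pos)

/-- A neighbourhood of the point is collapsed into a face on which `σ` is continuous. -/
theorem continuousAt_collapseOp {a : ℝ} (h : a < 1 / 2) {σ : Simplex n → X} {x : Simplex n}
    (hx : x ∈ tameSet a σ) : ContinuousAt (collapseOp n σ) x := by
  obtain ⟨G, hG, hx⟩ := hx
  have : ContinuousOn (collapseOp n σ) {y : Simplex n | ∀ j ∉ G, y j < 1 / 2 * y.height} :=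
    hG.comp (continuous_collapse.comp (by fun_prop)).continuousOn
      fun y hy j hj => collapse_eq_zero y j (hy j hj).le
  refine this.continuousAt ((isOpen_lt_height _ G).mem_nhds fun j hj => ?_)
  exact (hx j hj).trans_lt (mul_lt_mul_of_pos_right h x.height_pos)

end Tame

/-! ### The refinement step: jumps shrink by the factor `κ`. -/

section Refine

variable {X : Type*} [PseudoEMetricSpace X]

open Simplex

open Classical in
/-- Away from the faces where `σ` is continuous, replace `F σ` by the centers of the sets of its
values at nearby grid points. -/
def refineOp (c : Finset X → X) (N : ℕ) (a : ℝ) (F : ∀ n : ℕ, (Simplex n → X) → Simplex n → X)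
    (n : ℕ) (σ : Simplex n → X) (x : Simplex n) : X :=
  if x ∈ tameSet a σ then F n σ x else c ((heavyPoints N x).image (F n σ))

open Classical in
/-- Away from the faces where `σ` is continuous, replace `F σ` by its value at one of the closest
grid points. -/
def discretizeOp [Nonempty X] (N : ℕ) (a : ℝ) (F : ∀ n : ℕ, (Simplex n → X) → Simplex n → X)
    (n : ℕ) (σ : Simplex n → X) (x : Simplex n) : X :=
  if x ∈ tameSet a σ then F n σ x else
    Classical.epsilon fun y => y ∈ (heaviestPoints N x).image (F n σ)

variable {F : ∀ n : ℕ, (Simplex n → X) → Simplex n → X} {a : ℝ} {N : ℕ}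

theorem faceNatural_refineOp (hF : FaceNatural F) (c : Finset X → X) (hN : 0 < N) (ha : 0 ≤ a) :
    FaceNatural (refineOp c N a F) := fun n i σ x => by
  classical
  have h : (heavyPoints N (face i x)).image (F (n + 1) σ) =
      (heavyPoints N x).image (F n (σ ∘ face i)) := by
    rw [heavyPoints_face hN, Finset.image_image]
    exact Finset.image_congr fun y _ => (hF n i σ y).symm
  simp only [refineOp, face_mem_tameSet ha, hF n i σ x, h]

/-- The selected value depends only on the finite set of candidate values in `X`, not on the grid
points carrying them. That set is the same whether computed in a face or in the whole simplex. -/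
theorem faceNatural_discretizeOp [Nonempty X] (hF : FaceNatural F) (hN : 0 < N) (ha : 0 ≤ a) :
    FaceNatural (discretizeOp N a F) := fun n i σ x => by
  classical
  have h : (heaviestPoints N (face i x)).image (F (n + 1) σ) =
      (heaviestPoints N x).image (F n (σ ∘ face i)) := by
    rw [heaviestPoints_face hN, Finset.image_image]
    exact Finset.image_congr fun y _ => (hF n i σ y).symm
  simp only [discretizeOp, face_mem_tameSet ha, hF n i σ x, h]

theorem discretizeOp_mem [Nonempty X] (hN : 0 < N) {n : ℕ} {σ : Simplex n → X} {x : Simplex n}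
    (hx : x ∉ tameSet a σ) :
    ∃ w ∈ heaviestPoints N x, discretizeOp N a F n σ x = F n σ w := by
  classical
  obtain ⟨w, hw⟩ := heaviestPoints_nonempty hN x
  have : discretizeOp N a F n σ x ∈ (heaviestPoints N x).image (F n σ) := by
    rw [discretizeOp, if_neg hx]
    exact Classical.epsilon_spec (p := fun y => y ∈ (heaviestPoints N x).image (F n σ))
      ⟨_, Finset.mem_image_of_mem _ hw⟩
  obtain ⟨v, hv, h⟩ := Finset.mem_image.1 this
  exact ⟨v, hv, h.symm⟩

/-- The key step: centers improve the size of the jumps, at the cost of a homotopy without large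
jumps. -/
theorem eventually_fineMap_refineOp [Nonempty X] {r κ : ℝ≥0} (hκ0 : 0 < κ) (hκ1 : κ < 1)
    {c : Finset X → X}
    (hc : ∀ (T : Finset X) (D : ℝ≥0), T.Nonempty → D < r →
      (∀ s ∈ T, ∀ t ∈ T, edist s t ≤ D) →
      (∀ t ∈ T, edist t (c T) ≤ (κ * D : ℝ≥0)) ∧
      ∀ T' ⊆ T, T'.Nonempty → edist (c T') (c T) ≤ (κ * D : ℝ≥0))
    {D : ℝ≥0} (hD0 : 0 < D) (hDr : D < r) {b : ℝ} (hab : a < b) (hb : b ≤ 1 / 2) {n : ℕ}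
    {σ : Simplex n → X} (hfine : FineMap D (F n σ))
    (htame : ∀ x ∈ tameSet b σ, F n σ x = collapseOp n σ x) :
    ∀ᶠ N in atTop, FineMap (κ * D) (refineOp c N a F n σ) ∧
      CloseMaps D (F n σ) (discretizeOp N a F n σ) ∧
      CloseMaps D (discretizeOp N a F n σ) (refineOp c N a F n σ) := by
  classical
  set f := F n σ with hf
  -- The tolerance near tame points: one `e` to reach a value at a grid point, and at most `2 * e`,
  -- the diameter of these values, to reach their center.
  set e : ℝ≥0 := κ * D / 3 with he
  have he0 : 0 < e := by positivity
  have h3e : 3 * e = κ * D := by rw [he]; field_simp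
  have hκD : κ * D ≤ D := mul_le_of_le_one_left D.2 hκ1.le
  have heD : e ≤ κ * D := by rw [← h3e]; exact le_mul_of_one_le_left e.2 (by norm_num)
  obtain ⟨δ, hδ, hδf⟩ := hfine
  -- Around the compact set `tameSet a σ` the map is the collapsed one, by the strictly larger bound
  -- `b`; it is continuous at the points of this set, and compactness gives a uniform `η`.
  obtain ⟨η, hη, hηf⟩ : ∃ η : ℝ, 0 < η ∧ ∀ x ∈ tameSet a σ, ∀ y, dist x y < η →
      edist (f x) (f y) ≤ e := by
    have hK : IsCompact (tameSet a σ) := (isClosed_tameSet a σ).isCompact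
    have := hK.uniformContinuousAt_of_continuousAt f (fun x hx => by
      refine (continuousAt_collapseOp (hab.trans_le hb) hx).congr ?_
      filter_upwards [tameSet_mem_nhds hab hx] with y hy using (htame y hy).symm)
      (edist_mem_uniformity (ε := (e : ℝ≥0∞)) (by exact_mod_cast he0))
    obtain ⟨η, hη, h⟩ := Metric.mem_uniformity_dist.1 this
    exact ⟨η, hη, fun x hx y hxy => (h hxy hx).le⟩
  have hδ' : ∀ x y : Simplex n, dist x y < δ → edist (f x) (f y) ≤ D := fun x y hxy => by
    refine hδf x y ?_
    rw [edist_nndist, ENNReal.coe_lt_coe]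
    exact_mod_cast hxy
  -- Three radii $2/N$: grid points attached to two nearby points are compared through both of them.
  have hlim : Tendsto (fun N : ℕ => 3 * (2 / (N : ℝ))) atTop (𝓝 0) := by
    simpa using (tendsto_const_div_atTop_nhds_zero_nat (2 : ℝ)).const_mul (3 : ℝ)
  filter_upwards [hlim.eventually (gt_mem_nhds (lt_min (NNReal.coe_pos.2 hδ) hη)),
    eventually_gt_atTop 0] with N hN hN0
  set ρ : ℝ := 2 / N with hρ
  have hρ0 : 0 < ρ := by
    have : (0 : ℝ) < N := by exact_mod_cast hN0
    positivity
  have hρδ : 3 * ρ < δ := hN.trans_le (min_le_left _ _)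
  have hρη : 3 * ρ < η := hN.trans_le (min_le_right _ _)
  obtain ⟨ν, hν, hnest⟩ := exists_heavyPoints_nested hN0 n
  have hheavy : ∀ {x w : Simplex n}, w ∈ heavyPoints N x → dist x w < ρ :=
    fun h => dist_lt_of_mem_heavyPoints hN0 h
  have hheaviest : ∀ {x w : Simplex n}, w ∈ heaviestPoints N x → dist x w < ρ :=
    fun h => dist_lt_of_mem_heaviestPoints hN0 h
  have hne : ∀ x : Simplex n, ((heavyPoints N x).image f).Nonempty := fun x =>
    ((heaviestPoints_nonempty hN0 x).mono (heaviestPoints_subset hN0 x)).image f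
  have hdiam : ∀ x : Simplex n, ∀ s ∈ (heavyPoints N x).image f,
      ∀ t ∈ (heavyPoints N x).image f, edist s t ≤ D := by
    simp only [Finset.mem_image, forall_exists_index, and_imp, forall_apply_eq_imp_iff₂]
    intro x v hv w hw
    refine hδ' v w ?_
    linarith [dist_triangle_left v w x, hheavy hv, hheavy hw]
  set g := refineOp c N a F n σ with hg
  have hg_tame : ∀ {x}, x ∈ tameSet a σ → g x = f x := fun hx => if_pos hx
  have hg_wild : ∀ {x}, x ∉ tameSet a σ → g x = c ((heavyPoints N x).image f) :=
    fun hx => if_neg hx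
  set k := discretizeOp N a F n σ with hk
  have hk_tame : ∀ {x}, x ∈ tameSet a σ → k x = f x := fun hx => if_pos hx
  have hk_wild : ∀ {x}, x ∉ tameSet a σ → ∃ w ∈ heaviestPoints N x, k x = f w :=
    fun hx => discretizeOp_mem hN0 hx
  have hmixed : ∀ {x y}, dist x y < ρ → x ∈ tameSet a σ → y ∉ tameSet a σ →
      edist (f x) (g y) ≤ (κ * D : ℝ≥0) := by
    intro x y hxy hx hy
    have h1 : ∀ w ∈ heavyPoints N y, edist (f x) (f w) ≤ e := fun w hw =>
      hηf x hx w (by linarith [dist_triangle x y w, hheavy hw])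
    have h2 : ∀ s ∈ (heavyPoints N y).image f, ∀ t ∈ (heavyPoints N y).image f,
        edist s t ≤ (2 * e : ℝ≥0) := by
      simp only [Finset.mem_image, forall_exists_index, and_imp, forall_apply_eq_imp_iff₂]
      intro v hv w hw
      refine (edist_triangle_left _ _ (f x)).trans ((add_le_add (h1 v hv) (h1 w hw)).trans ?_)
      rw [← ENNReal.coe_add, ← two_mul]
    have h2e : 2 * e < r := lt_of_le_of_lt
      ((mul_le_mul_left (by norm_num) e).trans (h3e.le.trans hκD)) hDr
    obtain ⟨w, hw⟩ := (heaviestPoints_nonempty hN0 y).mono (heaviestPoints_subset hN0 y)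
    rw [hg_wild hy]
    calc edist (f x) (c ((heavyPoints N y).image f))
        ≤ edist (f x) (f w) + edist (f w) (c ((heavyPoints N y).image f)) := edist_triangle _ _ _
      _ ≤ e + (κ * (2 * e) : ℝ≥0) :=
          add_le_add (h1 w hw) ((hc _ _ (hne y) h2e h2).1 _ (Finset.mem_image_of_mem _ hw))
      _ ≤ (κ * D : ℝ≥0) := by
          rw [← ENNReal.coe_add, ENNReal.coe_le_coe, ← h3e]
          have : κ * (2 * e) ≤ 2 * e := mul_le_of_le_one_left (2 * e).2 hκ1.le
          calc e + κ * (2 * e) ≤ e + 2 * e := by gcongr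
            _ = 3 * e := by ring
  set ν' : ℝ≥0 := ⟨min ν ρ, (lt_min hν hρ0).le⟩ with hν'
  have hν'0 : 0 < ν' := by
    rw [← NNReal.coe_pos]
    exact lt_min hν hρ0
  have hedist : ∀ {x y : Simplex n}, edist x y < ν' → dist x y < ν ∧ dist x y < ρ := by
    intro x y h
    rw [edist_nndist, ENNReal.coe_lt_coe, ← NNReal.coe_lt_coe] at h
    exact ⟨h.trans_le (min_le_left _ _), h.trans_le (min_le_right _ _)⟩
  have hgg : ∀ x y, edist x y < ν' → edist (g x) (g y) ≤ (κ * D : ℝ≥0) := by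
    intro x y hxy
    obtain ⟨h1, h2⟩ := hedist hxy
    by_cases hx : x ∈ tameSet a σ <;> by_cases hy : y ∈ tameSet a σ
    · rw [hg_tame hx, hg_tame hy]
      exact (hηf x hx y (by linarith)).trans (by exact_mod_cast heD)
    · rw [hg_tame hx]
      exact hmixed h2 hx hy
    · rw [hg_tame hy, edist_comm]
      exact hmixed (by rwa [dist_comm]) hy hx
    · rw [hg_wild hx, hg_wild hy]
      rcases (hnest x y h1).2 with h | h
      -- The gain: the values at `x` form a subset of the values at `y`, so the two centers are
      -- within `κ * D`.
      · exact (hc _ D (hne y) hDr (hdiam y)).2 _ (Finset.image_subset_image h) (hne x)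
      · rw [edist_comm]
        exact (hc _ D (hne x) hDr (hdiam x)).2 _ (Finset.image_subset_image h) (hne y)
  have hff : ∀ x y, edist x y < ν' → edist (f x) (f y) ≤ D := fun x y hxy =>
    hδ' x y (by linarith [(hedist hxy).2])
  have hfk : ∀ x y, edist x y < ν' → edist (f x) (k y) ≤ D := by
    intro x y hxy
    by_cases hy : y ∈ tameSet a σ
    · rw [hk_tame hy]
      exact hff x y hxy
    · obtain ⟨w, hw, e⟩ := hk_wild hy
      rw [e]
      exact hδ' x w (by linarith [(hedist hxy).2, dist_triangle x y w, hheaviest hw])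
  have hkk : ∀ x y, edist x y < ν' → edist (k x) (k y) ≤ D := by
    intro x y hxy
    by_cases hx : x ∈ tameSet a σ
    · rw [hk_tame hx]
      exact hfk x y hxy
    · obtain ⟨v, hv, e⟩ := hk_wild hx
      rw [e]
      by_cases hy : y ∈ tameSet a σ
      · rw [hk_tame hy]
        exact hδ' v y (by linarith [(hedist hxy).2, dist_triangle_left v y x, hheaviest hv])
      · obtain ⟨w, hw, e⟩ := hk_wild hy
        rw [e]
        have h1 := dist_triangle_left v w x
        have h2 := dist_triangle x y w
        exact hδ' v w (by linarith [(hedist hxy).2, hheaviest hv, hheaviest hw])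
  -- A direct jump from `f` to `g` might exceed `D`. The detour through `k` avoids this: in the wild
  -- case `k x` is one of the values whose center is `g y`.
  have hkg : ∀ x y, edist x y < ν' → edist (k x) (g y) ≤ D := by
    intro x y hxy
    obtain ⟨h1, h2⟩ := hedist hxy
    by_cases hy : y ∈ tameSet a σ
    · rw [hg_tame hy, edist_comm]
      exact hfk y x (by rwa [edist_comm])
    · by_cases hx : x ∈ tameSet a σ
      · rw [hk_tame hx]
        exact (hmixed h2 hx hy).trans (by exact_mod_cast hκD)
      · obtain ⟨w, hw, e⟩ := hk_wild hx
        rw [e, hg_wild hy]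
        exact ((hc _ D (hne y) hDr (hdiam y)).1 _
          (Finset.mem_image_of_mem _ ((hnest x y h1).1 hw))).trans (by exact_mod_cast hκD)
  exact ⟨⟨ν', hν'0, hgg⟩, ⟨ν', hν'0, fun x y h => ⟨hff x y h, hfk x y h, hkk x y h⟩⟩,
    ⟨ν', hν'0, fun x y h => ⟨hkk x y h, hkg x y h,
      (hgg x y h).trans (by exact_mod_cast hκD)⟩⟩⟩

end Refine

theorem exists_seq_of_forall_exists_succ {α : Type*} {P : ℕ → α → Prop} {R : ℕ → α → α → Prop}
    {x : α} (h₀ : P 0 x) (h : ∀ k x, P k x → ∃ y, P (k + 1) y ∧ R k x y) :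
    ∃ f : ℕ → α, f 0 = x ∧ ∀ k, P k (f k) ∧ R k (f k) (f (k + 1)) := by
  choose! g hg using h
  let f : ℕ → α := fun k => Nat.rec x (fun k y => g k y) k
  have hf : ∀ k, P k (f k) := fun k => by
    induction k with
    | zero => exact h₀
    | succ k ih => exact (hg k _ ih).1
  exact ⟨f, rfl, fun k => ⟨hf k, (hg k _ (hf k)).2⟩⟩

/-! ### Iterated refinement and its continuous limit. -/

section Limit

variable {X : Type*}

/-- The properties of the approximations to an operation which makes maps continuous. -/
structure IsApprox [PseudoEMetricSpace X] (W : Set (Σ n, Simplex n → X)) (D : ℝ≥0) (a : ℝ)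
    (F : ∀ n : ℕ, (Simplex n → X) → Simplex n → X) : Prop where
  natural : FaceNatural F
  fine : ∀ p ∈ W, FineMap D (F p.1 p.2)
  tame : ∀ n (σ : Simplex n → X), ∀ x ∈ tameSet a σ, F n σ x = collapseOp n σ x

theorem continuous_collapseOp [TopologicalSpace X] {n : ℕ} {σ : Simplex n → X}
    (h : Continuous σ) : Continuous (collapseOp n σ) :=
  h.comp (Simplex.continuous_collapse.comp (by fun_prop))

theorem IsApprox.eq_collapseOp [PseudoEMetricSpace X] {W : Set (Σ n, Simplex n → X)} {D : ℝ≥0}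
    {a : ℝ} {F : ∀ n : ℕ, (Simplex n → X) → Simplex n → X} (hF : IsApprox W D a F) {n : ℕ}
    {σ : Simplex n → X} (h : Continuous σ) : F n σ = collapseOp n σ :=
  funext fun x => hF.tame n σ x (by rw [tameSet_of_continuous a h]; trivial)

theorem IsApprox.exists_refinement [PseudoEMetricSpace X] [Nonempty X] {r κ : ℝ≥0}
    (hX : HasCenters X r κ) (hκ0 : 0 < κ) (hκ1 : κ < 1) {ε : ℝ}
    {W : Set (Σ n, Simplex n → X)} (hW : W.Finite) {D : ℝ≥0} (hD0 : 0 < D) (hDr : D < r)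
    (hDε : (D : ℝ≥0∞) < ENNReal.ofReal ε) {a b : ℝ} (ha : 0 ≤ a) (hab : a < b) (hb : b ≤ 1 / 2)
    {F : ∀ n : ℕ, (Simplex n → X) → Simplex n → X} (hF : IsApprox W D b F) :
    ∃ G, IsApprox W (κ * D) a G ∧ OpHomotopic ε W F G ∧
      ∀ p ∈ W, ∀ x, edist (F p.1 p.2 x) (G p.1 p.2 x) ≤ (2 * D : ℝ≥0) := by
  obtain ⟨c, hc⟩ := hX
  have key : ∀ᶠ N in atTop, ∀ p ∈ W, FineMap (κ * D) (refineOp c N a F p.1 p.2) ∧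
      CloseMaps D (F p.1 p.2) (discretizeOp N a F p.1 p.2) ∧
      CloseMaps D (discretizeOp N a F p.1 p.2) (refineOp c N a F p.1 p.2) :=
    (eventually_all_finite hW).2 fun p hp =>
      eventually_fineMap_refineOp hκ0 hκ1 hc hD0 hDr hab hb (hF.fine p hp) (hF.tame p.1 p.2)
  obtain ⟨N, hN, hN0⟩ := (key.and (eventually_gt_atTop 0)).exists
  have hd : ∀ {n} {σ : Simplex n → X}, Continuous σ → discretizeOp N a F n σ = F n σ :=
    fun h => funext fun x => if_pos (by rw [tameSet_of_continuous a h]; trivial)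
  have hr : ∀ {n} {σ : Simplex n → X}, Continuous σ → refineOp c N a F n σ = F n σ :=
    fun h => funext fun x => if_pos (by rw [tameSet_of_continuous a h]; trivial)
  have hcont : ∀ {n} {σ : Simplex n → X}, Continuous σ → Continuous (F n σ) := fun h => by
    rw [hF.eq_collapseOp h]
    exact continuous_collapseOp h
  refine ⟨refineOp c N a F, ⟨faceNatural_refineOp hF.natural c hN0 ha,
    fun p hp => (hN p hp).1, fun n σ x hx => ?_⟩, ?_, fun p hp x => ?_⟩
  · exact (if_pos hx).trans (hF.tame n σ x (tameSet_mono hab.le σ hx))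
  · refine (OpHomotopic.of_closeMaps (G := discretizeOp N a F) hF.natural
      (faceNatural_discretizeOp hF.natural hN0 ha) (fun p hp => ⟨D, hDε, (hN p hp).2.1⟩)
      fun p _ h => ⟨hd h, hcont h⟩).trans
      (OpHomotopic.of_closeMaps (faceNatural_discretizeOp hF.natural hN0 ha)
      (faceNatural_refineOp hF.natural c hN0 ha) (fun p hp => ⟨D, hDε, (hN p hp).2.2⟩)
      fun p _ h => ⟨by rw [hd h, hr h], by rw [hd h]; exact hcont h⟩)
  · obtain ⟨-, ⟨δ, hδ, h⟩, ⟨δ', hδ', h'⟩⟩ := hN p hp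
    refine (edist_triangle _ (discretizeOp N a F p.1 p.2 x) _).trans ?_
    rw [two_mul, ENNReal.coe_add]
    exact add_le_add (h x x (by simpa using hδ)).2.1 (h' x x (by simpa using hδ')).2.1

/-- The supremum defining $\epsilon$-continuity is strictly below $\epsilon$, so one `D` below
$\epsilon$ serves the finitely many maps. -/
theorem exists_isApprox_collapseOp [PseudoEMetricSpace X] {ε : ℝ} (hε : 0 < ε)
    {W : Set (Σ n, Simplex n → X)} (hW : W.Finite) (hWε : ∀ p ∈ W, EpsContinuous ε p.2) (a : ℝ) :
    ∃ D : ℝ≥0, 0 < D ∧ (D : ℝ≥0∞) < ENNReal.ofReal ε ∧ IsApprox W D a collapseOp := by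
  have hε' : 0 < ε.toNNReal := Real.toNNReal_pos.2 hε
  have : (𝓝[<] ε.toNNReal).NeBot := nhdsLT_neBot_of_exists_lt ⟨_, hε'⟩
  have key : ∀ᶠ D in 𝓝[<] ε.toNNReal, ∀ p ∈ W, FineMap D (collapseOp p.1 p.2) := by
    refine (eventually_all_finite hW).2 fun p hp => ?_
    obtain ⟨D, hD, h⟩ := epsContinuous_iff.1 ((hWε p hp).comp_uniformContinuous
      (CompactSpace.uniformContinuous_of_continuous
        (Simplex.continuous_collapse.comp (f := fun x => (x, (1 : ℝ))) (by fun_prop))))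
    filter_upwards [Ioo_mem_nhdsLT (ENNReal.coe_lt_coe.1 hD)] with D' hD' using h.mono hD'.1.le
  obtain ⟨D, hD, hD'⟩ := (key.and (Ioo_mem_nhdsLT hε')).exists
  exact ⟨D, hD'.1, ENNReal.coe_lt_coe.2 hD'.2, faceNatural_collapseOp, hD, fun _ _ _ _ => rfl⟩

/-- A finite number of `ε`-continuous maps from simplices can be made continuous, by a homotopy
which is natural with respect to faces. -/
theorem exists_opHomotopic_continuous [EMetricSpace X] [CompleteSpace X] {r κ : ℝ≥0}
    (hX : Nonempty X → HasCenters X r κ) (hκ0 : 0 < κ) (hκ1 : κ < 1) {ε : ℝ} (hε : 0 < ε)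
    (hεr : ε ≤ r) {W : Set (Σ n, Simplex n → X)} (hW : W.Finite)
    (hWε : ∀ p ∈ W, EpsContinuous ε p.2) :
    ∃ τ, FaceNatural τ ∧ OpHomotopic ε W (fun _ σ => σ) τ ∧
      ∀ p ∈ W, Continuous (τ p.1 p.2) := by
  rcases isEmpty_or_nonempty X with hX' | hX'
  · have : ∀ n, IsEmpty (Simplex n → X) := fun n => ⟨fun σ => hX'.elim (σ Classical.ofNonempty)⟩
    exact ⟨fun _ σ => σ, fun n i σ x => rfl, ⟨fun n σ p => σ p.1, fun _ _ _ _ _ => rfl,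
      fun _ _ _ _ _ => rfl, fun _ _ _ _ _ => rfl, fun p => isEmptyElim p.2,
      fun p => isEmptyElim p.2⟩, fun p => isEmptyElim p.2⟩
  -- Each refinement needs some room between consecutive tame sets; the sequence starts at $1/2$,
  -- the collapsing threshold, and never becomes negative.
  let a : ℕ → ℝ := fun k => 1 / (k + 2)
  have ha : ∀ k, 0 ≤ a k := fun k => by positivity
  have ha' : ∀ k, a (k + 1) < a k := fun k => by
    refine one_div_lt_one_div_of_lt (by positivity) ?_
    push_cast
    linarith
  have hahalf : ∀ k, a k ≤ 1 / 2 := fun k =>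
    one_div_le_one_div_of_le (by norm_num) (by linarith [k.cast_nonneg (α := ℝ)])
  obtain ⟨D, hD0, hDε, h0⟩ := exists_isApprox_collapseOp hε hW hWε (a 0)
  have hDk : ∀ k, κ ^ k * D ≤ D := fun k => mul_le_of_le_one_left D.2 (pow_le_one₀ κ.2 hκ1.le)
  have hDr : D < r := by
    have := hDε.trans_le (ENNReal.ofReal_le_ofReal hεr)
    rwa [ENNReal.ofReal_coe_nnreal, ENNReal.coe_lt_coe] at this
  obtain ⟨F, hF0, hF⟩ := exists_seq_of_forall_exists_succ
    (P := fun k F => IsApprox W (κ ^ k * D) (a k) F)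
    (R := fun k F G => OpHomotopic ε W F G ∧
      ∀ p ∈ W, ∀ x, edist (F p.1 p.2 x) (G p.1 p.2 x) ≤ (2 * (κ ^ k * D) : ℝ≥0))
    (x := collapseOp) (by simpa using h0) fun k F hF => by
      obtain ⟨G, hG, h⟩ := hF.exists_refinement (hX hX') hκ0 hκ1 hW (by positivity)
        ((hDk k).trans_lt hDr) (lt_of_le_of_lt (by exact_mod_cast hDk k) hDε) (ha (k + 1))
        (ha' k) (hahalf k)
      exact ⟨G, by rwa [pow_succ', mul_assoc], h⟩
  -- For maps outside `W` the limit may not exist. Naturality still holds, because equal sequences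
  -- receive the same value of `limUnder`.
  let τ : ∀ n : ℕ, (Simplex n → X) → Simplex n → X :=
    fun n σ x => limUnder atTop fun k => F k n σ x
  have hτ : FaceNatural τ := fun n i σ x => by
    simp only [τ, (hF _).1.natural n i σ x]
  have hκ1' : (κ : ℝ≥0∞) < 1 := by exact_mod_cast hκ1
  have hu : ∀ p ∈ W, ∀ x k, edist (F k p.1 p.2 x) (F (k + 1) p.1 p.2 x) ≤
      (2 * D : ℝ≥0) * (κ : ℝ≥0∞) ^ k := fun p hp x k => by
    refine ((hF k).2.2 p hp x).trans (le_of_eq ?_)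
    rw [← ENNReal.coe_pow, ← ENNReal.coe_mul]
    congr 1
    ring
  let B : ℕ → ℝ≥0 := fun k => 2 * D * κ ^ k / (1 - κ)
  have hB : ∀ p ∈ W, ∀ x k, edist (F k p.1 p.2 x) (τ p.1 p.2 x) ≤ B k := fun p hp x k => by
    have := edist_le_of_edist_le_geometric_of_tendsto (κ : ℝ≥0∞) _ (hu p hp x)
      (cauchySeq_of_edist_le_geometric _ _ hκ1' ENNReal.coe_ne_top (hu p hp x)).tendsto_limUnder k
    refine this.trans (le_of_eq ?_)
    rw [ENNReal.coe_div (tsub_pos_of_lt hκ1).ne']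
    push_cast
    rfl
  -- A jump of the limit is compared with one of the `k`-th approximation, at the cost of the error
  -- `B k` at both ends.
  let A : ℕ → ℝ≥0 := fun k => B k + κ ^ k * D + B k
  have hA : Tendsto A atTop (𝓝 0) := by
    have h1 := NNReal.tendsto_pow_atTop_nhds_zero_of_lt_one hκ1
    have h2 : Tendsto B atTop (𝓝 0) := by
      simpa using (h1.const_mul (2 * D)).div_const (1 - κ)
    simpa using (h2.add (h1.mul_const D)).add h2
  have hclose : ∀ p ∈ W, ∀ k, CloseMaps (A k) (F k p.1 p.2) (τ p.1 p.2) := fun p hp k => by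
    obtain ⟨δ, hδ, h⟩ := (hF k).1.fine p hp
    refine ⟨δ, hδ, fun y z hyz => ⟨(h y z hyz).trans ?_, ?_, ?_⟩⟩
    · rw [ENNReal.coe_le_coe]
      exact le_add_right le_add_self
    · refine (edist_triangle _ (F k p.1 p.2 z) _).trans
        ((add_le_add (h y z hyz) (hB p hp z k)).trans ?_)
      rw [← ENNReal.coe_add, ENNReal.coe_le_coe]
      exact add_le_add_left le_add_self _
    · refine (edist_triangle4 _ (F k p.1 p.2 y) (F k p.1 p.2 z) _).trans
        ((add_le_add (add_le_add ((edist_comm _ _).trans_le (hB p hp y k)) (h y z hyz))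
          (hB p hp z k)).trans ?_)
      · rw [← ENNReal.coe_add, ← ENNReal.coe_add]
  have hcollapse : ∀ {n} {σ : Simplex n → X}, Continuous σ → τ n σ = collapseOp n σ :=
    fun h => funext fun x => by
      simp only [τ, (hF _).1.eq_collapseOp h]
      exact tendsto_const_nhds.limUnder_eq
  have hFk : ∀ k, OpHomotopic ε W (F 0) (F (k + 1)) := fun k => by
    induction k with
    | zero => exact (hF 0).2.1
    | succ k ih => exact ih.trans (hF (k + 1)).2.1
  refine ⟨τ, hτ, ?_, fun p hp => ?_⟩
  -- Only finitely many homotopies are concatenated; once the approximation is close enough, a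
  -- single jump leads to the limit.
  · obtain ⟨k, hk⟩ : ∃ k, A (k + 1) < D :=
      (((tendsto_add_atTop_iff_nat 1).2 hA).eventually (gt_mem_nhds hD0)).exists
    refine ((hF0 ▸ opHomotopic_collapseOp hWε).trans (hFk k)).trans
      (OpHomotopic.of_closeMaps (hF _).1.natural hτ
        (fun p hp => ⟨A (k + 1), lt_trans (by exact_mod_cast hk) hDε, hclose p hp _⟩)
        fun p hp h => ?_)
    rw [(hF _).1.eq_collapseOp h, hcollapse h]
    exact ⟨rfl, continuous_collapseOp h⟩
  · refine UniformContinuous.continuous (EMetric.uniformContinuous_iff.2 fun e he => ?_)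
    obtain ⟨e', he', hee⟩ := ENNReal.lt_iff_exists_nnreal_btwn.1 he
    obtain ⟨k, hk⟩ := (hA.eventually (gt_mem_nhds (ENNReal.coe_pos.1 he'))).exists
    obtain ⟨δ, hδ, h⟩ := hclose p hp k
    exact ⟨δ, by exact_mod_cast hδ, fun hxy => ((h _ _ hxy).2.2.trans
      (by exact_mod_cast hk.le)).trans_lt hee⟩

end Limit

/-! ### The prism decomposition. -/

section Combinatorics

/-- The combinatorics of the prism operator. -/
theorem sum_prism {G : Type*} [AddCommGroup G] (m : ℕ) (A B : ℕ → ℕ → G) (E : ℕ → G)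
    (h₁ : ∀ i ≤ m, A i i = E i) (h₂ : ∀ i ≤ m, A i (i + 1) = E (i + 1))
    (h₃ : ∀ i < m, ∀ j ≤ i, A (i + 1) j = B i j)
    (h₄ : ∀ j ≤ m, ∀ i < j, A i (j + 1) = B i j) :
    ∑ i ∈ Finset.range (m + 1), ∑ j ∈ Finset.range (m + 2), (-1 : ℤ) ^ (i + j) • A i j +
      ∑ i ∈ Finset.range m, ∑ j ∈ Finset.range (m + 1), (-1 : ℤ) ^ (i + j) • B i j =
      E 0 - E (m + 1) := by
  -- The terms with $j=i$ and $j=i+1$ telescope. Those with $j<i$ and with $j>i+1$ cancel against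
  -- the two halves of the double sum of `B`.
  have hA : ∀ i ∈ Finset.range (m + 1),
      ∑ j ∈ Finset.range (m + 2), (-1 : ℤ) ^ (i + j) • A i j =
      ∑ j ∈ Finset.range i, (-1 : ℤ) ^ (i + j) • A i j + (E i - E (i + 1)) +
        ∑ k ∈ Finset.range (m - i), (-1 : ℤ) ^ (i + (i + 2 + k)) • A i (i + 2 + k) := fun i hi => by
    have hi : i ≤ m := Nat.lt_succ_iff.1 (Finset.mem_range.1 hi)
    rw [show m + 2 = i + 2 + (m - i) by omega, Finset.sum_range_add, Finset.sum_range_succ,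
      Finset.sum_range_succ, h₁ i hi, h₂ i hi, ← two_mul, pow_mul, neg_one_sq, one_pow, one_smul,
      show i + (i + 1) = 2 * i + 1 by ring, pow_succ, pow_mul, neg_one_sq, one_pow, one_mul,
      neg_one_smul]
    abel
  have hB : ∀ i ∈ Finset.range m,
      ∑ j ∈ Finset.range (m + 1), (-1 : ℤ) ^ (i + j) • B i j =
      ∑ j ∈ Finset.range (i + 1), (-1 : ℤ) ^ (i + j) • B i j +
        ∑ k ∈ Finset.range (m - i), (-1 : ℤ) ^ (i + (i + 1 + k)) • B i (i + 1 + k) :=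
    fun i hi => by
    have hi : i < m := Finset.mem_range.1 hi
    rw [show m + 1 = i + 1 + (m - i) by omega, Finset.sum_range_add]
  have e₁ : ∑ i ∈ Finset.range (m + 1), ∑ j ∈ Finset.range i, (-1 : ℤ) ^ (i + j) • A i j =
      -∑ i ∈ Finset.range m, ∑ j ∈ Finset.range (i + 1), (-1 : ℤ) ^ (i + j) • B i j := by
    rw [Finset.sum_range_succ', Finset.range_zero, Finset.sum_empty, add_zero,
      ← Finset.sum_neg_distrib]
    refine Finset.sum_congr rfl fun i hi => ?_
    rw [← Finset.sum_neg_distrib]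
    refine Finset.sum_congr rfl fun j hj => ?_
    rw [h₃ i (Finset.mem_range.1 hi) j (Nat.lt_succ_iff.1 (Finset.mem_range.1 hj)),
      show i + 1 + j = i + j + 1 by ring, pow_succ, mul_neg_one, neg_smul]
  have e₂ : ∑ i ∈ Finset.range (m + 1), ∑ k ∈ Finset.range (m - i),
        (-1 : ℤ) ^ (i + (i + 2 + k)) • A i (i + 2 + k) =
      -∑ i ∈ Finset.range m, ∑ k ∈ Finset.range (m - i),
        (-1 : ℤ) ^ (i + (i + 1 + k)) • B i (i + 1 + k) := by
    rw [Finset.sum_range_succ, Nat.sub_self, Finset.range_zero, Finset.sum_empty, add_zero,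
      ← Finset.sum_neg_distrib]
    refine Finset.sum_congr rfl fun i hi => ?_
    rw [← Finset.sum_neg_distrib]
    refine Finset.sum_congr rfl fun k hk => ?_
    have hk := Finset.mem_range.1 hk
    rw [show i + 2 + k = i + 1 + k + 1 by ring, h₄ (i + 1 + k) (by omega) i (by omega),
      show i + (i + 1 + k + 1) = i + (i + 1 + k) + 1 by ring, pow_succ, mul_neg_one, neg_smul]
  rw [Finset.sum_congr rfl hA, Finset.sum_congr rfl hB, Finset.sum_add_distrib,
    Finset.sum_add_distrib, Finset.sum_add_distrib, e₁, e₂, Finset.sum_range_sub' E]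
  abel

end Combinatorics

theorem _root_.Fin.val_succAbove_eq_ite {n : ℕ} (j : Fin (n + 1)) (k : Fin n) :
    (j.succAbove k : ℕ) = if k.val < j.val then k.val else k.val + 1 := by
  simp only [Fin.succAbove, Fin.lt_def, Fin.val_castSucc]
  split_ifs <;> rfl

theorem _root_.Fin.val_predAbove_eq_ite {n : ℕ} (i : Fin n) (k : Fin (n + 1)) :
    (i.predAbove k : ℕ) = if i.val < k.val then k.val - 1 else k.val := by
  simp only [Fin.predAbove, Fin.lt_def, Fin.val_castSucc]
  split_ifs <;> rfl

namespace Simplex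

variable {n : ℕ}

/-- The sum of the coordinates with index at least `r`. -/
def upperSum (r : ℕ) (x : Simplex n) : ℝ := ∑ k : Fin (n + 1), if r ≤ k.val then x k else 0

theorem continuous_upperSum (r : ℕ) : Continuous (upperSum r : Simplex n → ℝ) :=
  continuous_finsetSum _ fun k _ => by
    split_ifs
    exacts [continuous_coord k, continuous_const]

theorem upperSum_zero (x : Simplex n) : upperSum 0 x = 1 := by
  simp only [upperSum, zero_le, if_true]
  exact x.2.2

theorem upperSum_succ_self (x : Simplex n) : upperSum (n + 1) x = 0 :=
  Finset.sum_eq_zero fun k _ => if_neg (by omega)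

theorem upperSum_face_of_le {r : ℕ} {j : Fin (n + 2)} (h : r ≤ j) (x : Simplex n) :
    upperSum r (face j x) = upperSum r x := by
  rw [upperSum, Fin.sum_univ_succAbove _ j, face_self, ite_self, zero_add]
  refine Finset.sum_congr rfl fun k _ => ?_
  rw [face_succAbove]
  congr 1
  rw [Fin.val_succAbove_eq_ite, eq_iff_iff]
  split_ifs <;> omega

theorem upperSum_succ_face_of_le {r : ℕ} {j : Fin (n + 2)} (h : j ≤ r) (x : Simplex n) :
    upperSum (r + 1) (face j x) = upperSum r x := by
  rw [upperSum, Fin.sum_univ_succAbove _ j, face_self, ite_self, zero_add]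
  refine Finset.sum_congr rfl fun k _ => ?_
  rw [face_succAbove]
  congr 1
  rw [Fin.val_succAbove_eq_ite, eq_iff_iff]
  split_ifs <;> omega

/-- The `i`-th degeneracy. -/
def degen (i : Fin (n + 1)) : Simplex (n + 1) → Simplex n := stdSimplex.map i.predAbove

theorem continuous_degen (i : Fin (n + 1)) : Continuous (degen i) := stdSimplex.continuous_map _

theorem degen_face_eq_self {i : Fin (n + 1)} {j : Fin (n + 2)}
    (h : j.val = i.val ∨ j.val = i.val + 1) (x : Simplex n) : degen i (face j x) = x := by
  have : i.predAbove ∘ j.succAbove = id := by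
    ext k
    rw [Function.comp_apply, Fin.val_predAbove_eq_ite, Fin.val_succAbove_eq_ite, id]
    split_ifs <;> omega
  rw [degen, face, stdSimplex.map_comp_apply, this, stdSimplex.map_id_apply]

theorem degen_face_eq_face_degen {i : Fin (n + 2)} {j : Fin (n + 3)} {i' : Fin (n + 1)}
    {j' : Fin (n + 2)}
    (h : i.val = i'.val + 1 ∧ j.val = j'.val ∧ j'.val ≤ i'.val ∨
      i.val = i'.val ∧ j.val = j'.val + 1 ∧ i'.val < j'.val) (x : Simplex (n + 1)) :
    degen i (face j x) = face j' (degen i' x) := by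
  have : i.predAbove ∘ j.succAbove = j'.succAbove ∘ i'.predAbove := by
    ext k
    simp only [Function.comp_apply, Fin.val_predAbove_eq_ite, Fin.val_succAbove_eq_ite]
    split_ifs <;> omega
  rw [degen, face, stdSimplex.map_comp_apply, this, ← stdSimplex.map_comp_apply, degen, face]

end Simplex

/-! ### Chains of arbitrary maps, with prism operators. -/

section MapChain

open Simplex

/-- The group of chains of arbitrary maps from simplices. -/
abbrev MapChain (X : Type*) (n : ℕ) : Type _ := (Simplex n → X) →₀ ℤ

variable {X : Type*}

/-- The boundary of a chain of maps from simplices. -/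
def boundary (n : ℕ) : MapChain X (n + 1) →ₗ[ℤ] MapChain X n :=
  Finsupp.linearCombination ℤ fun σ =>
    ∑ i : Fin (n + 2), (-1 : ℤ) ^ i.val • Finsupp.single (σ ∘ face i) 1

theorem boundary_single (n : ℕ) (σ : Simplex (n + 1) → X) :
    boundary n (Finsupp.single σ 1) =
      ∑ i : Fin (n + 2), (-1 : ℤ) ^ i.val • Finsupp.single (σ ∘ face i) 1 := by
  rw [boundary, Finsupp.linearCombination_single, one_smul]

/-- The action of an operation on chains. -/
def mapOp (F : ∀ n : ℕ, (Simplex n → X) → Simplex n → X) (n : ℕ) :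
    MapChain X n →ₗ[ℤ] MapChain X n :=
  Finsupp.linearCombination ℤ fun σ => Finsupp.single (F n σ) 1

theorem mapOp_single (F : ∀ n : ℕ, (Simplex n → X) → Simplex n → X) (n : ℕ) (σ : Simplex n → X) :
    mapOp F n (Finsupp.single σ 1) = Finsupp.single (F n σ) 1 := by
  rw [mapOp, Finsupp.linearCombination_single, one_smul]

theorem boundary_mapOp {F : ∀ n : ℕ, (Simplex n → X) → Simplex n → X} (hF : FaceNatural F) (n : ℕ)
    (a : MapChain X (n + 1)) : boundary n (mapOp F (n + 1) a) = mapOp F n (boundary n a) := by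
  suffices boundary n ∘ₗ mapOp F (n + 1) = mapOp F n ∘ₗ boundary n from congr($this a)
  refine Finsupp.lhom_ext' fun σ => LinearMap.ext_ring ?_
  simp only [LinearMap.comp_apply, Finsupp.lsingle_apply, mapOp_single, boundary_single, map_sum,
    map_smul]
  refine Finset.sum_congr rfl fun i _ => ?_
  have : F n (σ ∘ face i) = F (n + 1) σ ∘ face i := funext fun x => hF n i σ x
  rw [this]

variable (H : ∀ n : ℕ, (Simplex n → X) → Simplex n × ℝ → X)

/-- The `i`-th simplex of the prism of a homotopy. -/
def prismMap {n : ℕ} (i : Fin (n + 1)) (σ : Simplex n → X) (y : Simplex (n + 1)) : X :=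
  -- In the prism, vertex `k` goes to vertex `k` at time 0 if `k ≤ i`, and to vertex `k - 1` at time
  -- 1 otherwise.
  H n σ (degen i y, upperSum (i + 1) y)

/-- The prism operator of a homotopy. -/
def prism (n : ℕ) : MapChain X n →ₗ[ℤ] MapChain X (n + 1) :=
  Finsupp.linearCombination ℤ fun σ =>
    ∑ i : Fin (n + 1), (-1 : ℤ) ^ i.val • Finsupp.single (prismMap H i σ) 1

theorem prism_single (n : ℕ) (σ : Simplex n → X) :
    prism H n (Finsupp.single σ 1) =
      ∑ i : Fin (n + 1), (-1 : ℤ) ^ i.val • Finsupp.single (prismMap H i σ) 1 := by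
  rw [prism, Finsupp.linearCombination_single, one_smul]

theorem boundary_prism_single (n : ℕ) (σ : Simplex n → X) :
    boundary n (prism H n (Finsupp.single σ 1)) =
      ∑ i : Fin (n + 1), ∑ j : Fin (n + 2),
        (-1 : ℤ) ^ (i.val + j.val) • Finsupp.single (prismMap H i σ ∘ face j) 1 := by
  simp only [prism_single, map_sum, map_smul, boundary_single, Finset.smul_sum, smul_smul, pow_add]

theorem prism_boundary_single (n : ℕ) (σ : Simplex (n + 1) → X) :
    prism H n (boundary n (Finsupp.single σ 1)) =
      ∑ i : Fin (n + 1), ∑ j : Fin (n + 2),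
        (-1 : ℤ) ^ (i.val + j.val) • Finsupp.single (prismMap H i (σ ∘ face j)) 1 := by
  simp only [boundary_single, map_sum, map_smul, prism_single, Finset.smul_sum, smul_smul]
  rw [Finset.sum_comm]
  simp only [pow_add, mul_comm]

theorem prismMap_comp_face_eq {n : ℕ} {i : Fin (n + 1)} {j : Fin (n + 2)}
    (h : j.val = i.val ∨ j.val = i.val + 1) (σ : Simplex n → X) :
    prismMap H i σ ∘ face j = fun x => H n σ (x, upperSum j x) := funext fun x => by
  rw [Function.comp_apply, prismMap, degen_face_eq_self h]
  rcases h with h | h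
  · rw [upperSum_succ_face_of_le h.le, h]
  · rw [← h, upperSum_face_of_le le_rfl]

variable {H}

theorem prismMap_comp_face
    (hH : ∀ n (i : Fin (n + 2)) (σ : Simplex (n + 1) → X) (x : Simplex n) (t : ℝ),
      H n (σ ∘ face i) (x, t) = H (n + 1) σ (face i x, t))
    {n : ℕ} {i : Fin (n + 2)} {j : Fin (n + 3)} {i' : Fin (n + 1)} {j' : Fin (n + 2)}
    (h : i.val = i'.val + 1 ∧ j.val = j'.val ∧ j'.val ≤ i'.val ∨
      i.val = i'.val ∧ j.val = j'.val + 1 ∧ i'.val < j'.val) (σ : Simplex (n + 1) → X) :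
    prismMap H i σ ∘ face j = prismMap H i' (σ ∘ face j') := funext fun x => by
  rw [Function.comp_apply, prismMap, prismMap, degen_face_eq_face_degen h, hH]
  rcases h with ⟨h₁, h₂, h₃⟩ | ⟨h₁, h₂, h₃⟩
  · rw [upperSum_succ_face_of_le (by omega), h₁]
  · rw [upperSum_face_of_le (by omega), h₁]

variable {F G : ∀ n : ℕ, (Simplex n → X) → Simplex n → X}

/-- The prism operator is a chain homotopy. -/
theorem boundary_prism_add
    (hH : ∀ n (i : Fin (n + 2)) (σ : Simplex (n + 1) → X) (x : Simplex n) (t : ℝ),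
      H n (σ ∘ face i) (x, t) = H (n + 1) σ (face i x, t))
    (h0 : ∀ n σ x, H n σ (x, 0) = F n σ x) (h1 : ∀ n σ x, H n σ (x, 1) = G n σ x) {n : ℕ}
    (a : MapChain X (n + 1)) :
    boundary (n + 1) (prism H (n + 1) a) + prism H n (boundary n a) =
      mapOp G (n + 1) a - mapOp F (n + 1) a := by
  suffices boundary (n + 1) ∘ₗ prism H (n + 1) + prism H n ∘ₗ boundary n =
    mapOp G (n + 1) - mapOp F (n + 1) from congr($this a)
  refine Finsupp.lhom_ext' fun σ => LinearMap.ext_ring ?_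
  simp only [LinearMap.comp_apply, LinearMap.add_apply, LinearMap.sub_apply,
    Finsupp.lsingle_apply, mapOp_single, boundary_prism_single, prism_boundary_single]
  -- The `Fin` sums are extended by zero to natural indices. The function `E` interpolates from `G`,
  -- at `upperSum 0 = 1`, to `F`, at `upperSum (n + 2) = 0`.
  have key := sum_prism (n + 1)
    (fun i j => if h : i < n + 2 ∧ j < n + 3 then
      Finsupp.single (prismMap H ⟨i, h.1⟩ σ ∘ face ⟨j, h.2⟩) (1 : ℤ) else 0)
    (fun i j => if h : i < n + 1 ∧ j < n + 2 then
      Finsupp.single (prismMap H ⟨i, h.1⟩ (σ ∘ face ⟨j, h.2⟩)) (1 : ℤ) else 0)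
    (fun r => Finsupp.single (fun x => H (n + 1) σ (x, upperSum r x)) 1)
    (fun i hi => by
      rw [dif_pos ⟨by omega, by omega⟩, prismMap_comp_face_eq H (Or.inl rfl)])
    (fun i hi => by
      rw [dif_pos ⟨by omega, by omega⟩, prismMap_comp_face_eq H (Or.inr rfl)])
    (fun i hi j hj => by
      rw [dif_pos ⟨by omega, by omega⟩, dif_pos ⟨by omega, by omega⟩,
        prismMap_comp_face hH (i' := ⟨i, by omega⟩) (j' := ⟨j, by omega⟩)
          (Or.inl ⟨rfl, rfl, hj⟩)])
    (fun j hj i hi => by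
      rw [dif_pos ⟨by omega, by omega⟩, dif_pos ⟨by omega, by omega⟩,
        prismMap_comp_face hH (i' := ⟨i, by omega⟩) (j' := ⟨j, by omega⟩)
          (Or.inr ⟨rfl, rfl, hi⟩)])
  simp only [Finset.sum_range, Fin.is_lt, and_self, dite_true, upperSum_zero, upperSum_succ_self,
    h0, h1] at key
  exact key

theorem boundary_prism_zero (h0 : ∀ n σ x, H n σ (x, 0) = F n σ x)
    (h1 : ∀ n σ x, H n σ (x, 1) = G n σ x) (a : MapChain X 0) :
    boundary 0 (prism H 0 a) = mapOp G 0 a - mapOp F 0 a := by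
  suffices boundary 0 ∘ₗ prism H 0 = mapOp G 0 - mapOp F 0 from congr($this a)
  refine Finsupp.lhom_ext' fun σ => LinearMap.ext_ring ?_
  simp only [LinearMap.comp_apply, LinearMap.sub_apply,
    Finsupp.lsingle_apply, mapOp_single, boundary_prism_single]
  have key := sum_prism 0
    (fun i j => if h : i < 1 ∧ j < 2 then
      Finsupp.single (prismMap H ⟨i, h.1⟩ σ ∘ face ⟨j, h.2⟩) (1 : ℤ) else 0)
    (fun _ _ => 0)
    (fun r => Finsupp.single (fun x => H 0 σ (x, upperSum r x)) 1)
    (fun i hi => by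
      rw [dif_pos ⟨by omega, by omega⟩, prismMap_comp_face_eq H (Or.inl rfl)])
    (fun i hi => by
      rw [dif_pos ⟨by omega, by omega⟩, prismMap_comp_face_eq H (Or.inr rfl)])
    (fun i hi j hj => by omega)
    (fun j hj i hi => by omega)
  simp only [Finset.sum_range, Fin.is_lt, and_self, dite_true, upperSum_zero, upperSum_succ_self,
    h0, h1, Finset.univ_eq_empty, Finset.sum_empty, add_zero] at key
  exact key

theorem mapOp_id (n : ℕ) (a : MapChain X n) : mapOp (fun _ σ => σ) n a = a := by
  suffices mapOp (fun _ σ => σ) n = (LinearMap.id : MapChain X n →ₗ[ℤ] _) from congr($this a)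
  refine Finsupp.lhom_ext' fun σ => LinearMap.ext_ring ?_
  simp [mapOp_single]

/-- The chains of maps from simplices which satisfy a condition. -/
abbrev chainsOf (P : ∀ n, Set (Simplex n → X)) (n : ℕ) : Submodule ℤ (MapChain X n) :=
  Finsupp.supported ℤ ℤ (P n)

theorem linearCombination_mem_of_forall_mem {α M : Type*} [AddCommGroup M] {f : α → M}
    {S : Submodule ℤ M} {a : α →₀ ℤ} (h : ∀ x ∈ a.support, f x ∈ S) :
    Finsupp.linearCombination ℤ f a ∈ S := by
  rw [Finsupp.linearCombination_apply]
  exact Submodule.sum_mem _ fun x hx => S.smul_mem _ (h x hx)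

theorem prism_mem_chainsOf {P : ∀ n, Set (Simplex n → X)} {n : ℕ} {a : MapChain X n}
    (h : ∀ σ ∈ a.support, ∀ i, prismMap H i σ ∈ P (n + 1)) : prism H n a ∈ chainsOf P (n + 1) :=
  linearCombination_mem_of_forall_mem fun σ hσ => Submodule.sum_mem _ fun i _ =>
    Submodule.smul_mem _ _ (Finsupp.single_mem_supported ℤ _ (h σ hσ i))

theorem mapOp_mem_chainsOf {P : ∀ n, Set (Simplex n → X)} {n : ℕ} {a : MapChain X n}
    (h : ∀ σ ∈ a.support, F n σ ∈ P n) : mapOp F n a ∈ chainsOf P n :=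
  linearCombination_mem_of_forall_mem fun σ hσ => Finsupp.single_mem_supported ℤ _ (h σ hσ)

end MapChain

/-! ### Replacing chains by chains of continuous maps. -/

section Approximation

open Simplex

variable {X : Type*} [EMetricSpace X]

theorem continuous_prism_coordinates {n : ℕ} (i : Fin (n + 1)) :
    Continuous fun y : Simplex (n + 1) => (degen i y, upperSum (i + 1) y) :=
  (continuous_degen i).prodMk (continuous_upperSum _)

/-- A chain is a cycle if its boundary is zero; in degree `0` this is no condition. -/
def IsCycle {X : Type*} : ∀ {n : ℕ}, MapChain X n → Prop
  | 0, _ => True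
  | n + 1, a => boundary n a = 0

theorem IsCycle.mapOp {X : Type*} {F : ∀ n : ℕ, (Simplex n → X) → Simplex n → X}
    (hF : FaceNatural F) {n : ℕ} {a : MapChain X n} (ha : IsCycle a) : IsCycle (mapOp F n a) := by
  cases n with
  | zero => trivial
  | succ n =>
    change boundary n a = 0 at ha
    change boundary n _ = 0
    rw [boundary_mapOp hF, ha, map_zero]

/-- The chains of `ε`-continuous maps. -/
abbrev epsChains (X : Type*) [PseudoEMetricSpace X] (ε : ℝ) (n : ℕ) : Submodule ℤ (MapChain X n) :=
  chainsOf (fun _ => {σ | EpsContinuous ε σ}) n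

/-- The chains of continuous maps. -/
abbrev contChains (X : Type*) [TopologicalSpace X] (n : ℕ) : Submodule ℤ (MapChain X n) :=
  chainsOf (fun _ => {σ | Continuous σ}) n

variable [CompleteSpace X] {r κ : ℝ≥0}

/-- Chains of `ε`-continuous maps are naturally homotopic to chains of continuous maps. -/
theorem exists_continuous_approximation (hX : Nonempty X → HasCenters X r κ) (hκ0 : 0 < κ)
    (hκ1 : κ < 1) {ε : ℝ} (hε : 0 < ε) (hεr : ε ≤ r) {n : ℕ} {a : MapChain X n}
    (ha : a ∈ epsChains X ε n) {b : MapChain X (n + 1)} (hb : b ∈ epsChains X ε (n + 1)) :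
    ∃ τ : ∀ n : ℕ, (Simplex n → X) → Simplex n → X, FaceNatural τ ∧ mapOp τ n a ∈ contChains X n ∧
      mapOp τ (n + 1) b ∈ contChains X (n + 1) ∧
      (IsCycle a → ∃ c ∈ epsChains X ε (n + 1), boundary n c = mapOp τ n a - a ∧
        (a ∈ contChains X n → c ∈ contChains X (n + 1))) := by
  -- The faces of these simplices need not be included: the prism is applied only to `a`, and the
  -- term involving its boundary vanishes for a cycle.
  let W : Set (Σ n, Simplex n → X) :=
    Sigma.mk n '' (a.support : Set (Simplex n → X)) ∪
      Sigma.mk (n + 1) '' (b.support : Set (Simplex (n + 1) → X))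
  have hWa : ∀ σ ∈ a.support, (⟨n, σ⟩ : Σ n, Simplex n → X) ∈ W := fun σ hσ =>
    Or.inl (mem_image_of_mem _ hσ)
  have hWb : ∀ σ ∈ b.support, (⟨n + 1, σ⟩ : Σ n, Simplex n → X) ∈ W := fun σ hσ =>
    Or.inr (mem_image_of_mem _ hσ)
  have hW : W.Finite := (a.support.finite_toSet.image _).union (b.support.finite_toSet.image _)
  have hWε : ∀ p ∈ W, EpsContinuous ε p.2 := by
    rintro _ (⟨σ, hσ, rfl⟩ | ⟨σ, hσ, rfl⟩)
    · exact ha hσ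
    · exact hb hσ
  obtain ⟨τ, hτ, ⟨H, hH⟩, hτc⟩ := exists_opHomotopic_continuous hX hκ0 hκ1 hε hεr hW hWε
  refine ⟨τ, hτ, mapOp_mem_chainsOf fun σ hσ => hτc _ (hWa σ hσ),
    mapOp_mem_chainsOf fun σ hσ => hτc _ (hWb σ hσ), fun hcyc =>
      ⟨prism H n a, prism_mem_chainsOf fun σ hσ i => ?_, ?_, fun hac =>
        prism_mem_chainsOf fun σ hσ i => ?_⟩⟩
  · exact (hH.eps _ (hWa σ hσ)).comp_uniformContinuous
      (CompactSpace.uniformContinuous_of_continuous (continuous_prism_coordinates i))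
  · have h0 : ∀ n σ x, H n σ (x, 0) = σ x := fun n σ x => hH.left n σ x 0 le_rfl
    have h1 : ∀ n σ x, H n σ (x, 1) = τ n σ x := fun n σ x => hH.right n σ x 1 le_rfl
    cases n with
    | zero => rw [boundary_prism_zero h0 h1, mapOp_id]
    | succ n =>
      have := boundary_prism_add hH.natural h0 h1 a
      rwa [show boundary n a = 0 from hcyc, map_zero, add_zero, mapOp_id] at this
  · exact (hH.cont _ (hWa σ hσ) (hac hσ)).comp (continuous_prism_coordinates i)

end Approximation

section Approximation

variable {X : Type*} [EMetricSpace X] [CompleteSpace X] {r κ : ℝ≥0}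

/-- This gives surjectivity in homology. -/
theorem exists_continuous_cycle (hX : Nonempty X → HasCenters X r κ) (hκ0 : 0 < κ)
    (hκ1 : κ < 1) {ε : ℝ} (hε : 0 < ε) (hεr : ε ≤ r) {n : ℕ} {a : MapChain X n}
    (ha : a ∈ epsChains X ε n) (hcyc : IsCycle a) :
    ∃ a' ∈ contChains X n, IsCycle a' ∧ ∃ c ∈ epsChains X ε (n + 1), boundary n c = a' - a := by
  obtain ⟨τ, hτ, h₁, -, h₂⟩ := exists_continuous_approximation hX hκ0 hκ1 hε hεr ha
    (Submodule.zero_mem (epsChains X ε (n + 1)))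
  obtain ⟨c, hc, h, -⟩ := h₂ hcyc
  exact ⟨_, h₁, hcyc.mapOp hτ, c, hc, h⟩

/-- This gives injectivity in homology. With $\partial c=\tau a-a$ and `c` continuous, the chain
$\tau b-c$ is continuous and has boundary `a`. -/
theorem exists_continuous_boundary (hX : Nonempty X → HasCenters X r κ) (hκ0 : 0 < κ)
    (hκ1 : κ < 1) {ε : ℝ} (hε : 0 < ε) (hεr : ε ≤ r) {n : ℕ} {a : MapChain X n}
    (ha : a ∈ contChains X n) (hcyc : IsCycle a) {b : MapChain X (n + 1)}
    (hb : b ∈ epsChains X ε (n + 1)) (hab : boundary n b = a) :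
    ∃ b' ∈ contChains X (n + 1), boundary n b' = a := by
  have ha' : a ∈ epsChains X ε n := fun σ hσ => EpsContinuous.of_uniformContinuous hε
    (CompactSpace.uniformContinuous_of_continuous (ha hσ))
  obtain ⟨τ, hτ, -, h₁, h₂⟩ := exists_continuous_approximation hX hκ0 hκ1 hε hεr ha' hb
  obtain ⟨c, -, h, hc⟩ := h₂ hcyc
  refine ⟨mapOp τ (n + 1) b - c, Submodule.sub_mem _ h₁ (hc ha), ?_⟩
  rw [map_sub, boundary_mapOp hτ, hab, h, sub_sub_cancel]

end Approximation

/-! ### Chain complexes of simplicial sets as subcomplexes of `MapChain`. -/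

section Realization

universe u

open Simplicial

/-- The generator of the chain group which corresponds to a simplex. -/
def simplexChain (S : SSet.{u}) {n : ℕ} (σ : S _⦋n⦌) : (S.chainComplex coeffZ.{u}).X n :=
  S.ιChainComplex (R := coeffZ.{u}) σ ⟨1⟩

theorem hom_ext_simplexChain {S : SSet.{u}} {n : ℕ} {G : AddCommGrpCat.{u}}
    {f g : (S.chainComplex coeffZ.{u}).X n ⟶ G}
    (h : ∀ σ, f (simplexChain S σ) = g (simplexChain S σ)) : f = g := by
  refine SSet.chainComplex_hom_ext fun σ => ConcreteCategory.hom_ext _ _ fun k => ?_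
  have : k = k.down • (⟨1⟩ : ULift.{u} ℤ) := by
    ext; simp
  rw [this, map_zsmul, map_zsmul]
  exact congrArg _ (h σ)

theorem d_simplexChain (S : SSet.{u}) {n : ℕ} (σ : S _⦋n + 1⦌) :
    (S.chainComplex coeffZ.{u}).d (n + 1) n (simplexChain S σ) =
      ∑ i : Fin (n + 2), (-1 : ℤ) ^ i.val • simplexChain S (S.δ i σ) := by
  have := congr($(S.ιChainComplex_d coeffZ.{u} σ) ⟨1⟩)
  let ev : (coeffZ.{u} ⟶ (S.chainComplex coeffZ.{u}).X n) →+ (S.chainComplex coeffZ.{u}).X n :=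
    ⟨⟨fun φ => φ ⟨1⟩, rfl⟩, fun _ _ => rfl⟩
  refine this.trans ((map_sum ev _ _).trans (Finset.sum_congr rfl fun i _ => ?_))
  exact map_zsmul ev _ _

theorem chainComplexMap_simplexChain {S T : SSet.{u}} (f : S ⟶ T) {n : ℕ} (σ : S _⦋n⦌) :
    (SSet.chainComplexMap f coeffZ.{u}).f n (simplexChain S σ) = simplexChain T (f.app _ σ) :=
  congr($(S.ι_chainComplexMap_f T f coeffZ.{u} σ) ⟨1⟩)

/-- The homomorphism from a chain group with given values on simplices. -/
def chainDesc (S : SSet.{u}) {n : ℕ} {G : AddCommGrpCat.{u}} (f : S _⦋n⦌ → G) :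
    (S.chainComplex coeffZ.{u}).X n ⟶ G :=
  (S.isColimitChainComplexXCofan coeffZ.{u} n).desc (Limits.Cofan.mk G fun σ =>
    AddCommGrpCat.ofHom (((zmultiplesHom G) (f σ)).comp AddEquiv.ulift.toAddMonoidHom))

theorem chainDesc_simplexChain (S : SSet.{u}) {n : ℕ} {G : AddCommGrpCat.{u}} (f : S _⦋n⦌ → G)
    (σ : S _⦋n⦌) : chainDesc S f (simplexChain S σ) = f σ := by
  have := congr($((S.isColimitChainComplexXCofan coeffZ.{u} n).fac (Limits.Cofan.mk G fun σ =>
    AddCommGrpCat.ofHom (((zmultiplesHom G) (f σ)).comp AddEquiv.ulift.toAddMonoidHom)) ⟨σ⟩) ⟨1⟩)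
  refine this.trans ?_
  simp only [Limits.Cofan.mk_ι_app]
  exact one_zsmul (f σ)

/-- An embedding of a simplicial set in the system of all maps from simplices to `X`. -/
structure MapRealization (S : SSet.{u}) (X : Type u) where
  /-- The map from a simplex to `X`. -/
  map : ∀ n, S _⦋n⦌ → Simplex n → X
  injective : ∀ n, Function.Injective (map n)
  map_δ : ∀ n (i : Fin (n + 2)) (σ : S _⦋n + 1⦌), map n (S.δ i σ) = map (n + 1) σ ∘ Simplex.face i

namespace MapRealization

variable {S : SSet.{u}} {X : Type u} (J : MapRealization S X)

/-- The embedding of the chains. -/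
def real (n : ℕ) : (S.chainComplex coeffZ.{u}).X n →+ MapChain X n :=
  (chainDesc S (G := AddCommGrpCat.of (MapChain X n)) fun σ => Finsupp.single (J.map n σ) 1).hom

theorem real_simplexChain {n : ℕ} (σ : S _⦋n⦌) :
    J.real n (simplexChain S σ) = Finsupp.single (J.map n σ) 1 :=
  chainDesc_simplexChain S (G := AddCommGrpCat.of (MapChain X n)) _ σ

/-- The chain with given coefficients. -/
def ofFinsupp (S : SSet.{u}) (n : ℕ) : (S _⦋n⦌ →₀ ℤ) →ₗ[ℤ] (S.chainComplex coeffZ.{u}).X n :=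
  Finsupp.linearCombination ℤ (simplexChain S)

theorem ofFinsupp_surjective (n : ℕ) : Function.Surjective (ofFinsupp S n) := by
  let f : (S.chainComplex coeffZ.{u}).X n ⟶ AddCommGrpCat.of (S _⦋n⦌ →₀ ℤ) :=
    chainDesc S fun σ => Finsupp.single σ 1
  have : f ≫ AddCommGrpCat.ofHom (ofFinsupp S n).toAddMonoidHom = 𝟙 _ := by
    refine hom_ext_simplexChain fun σ => ?_
    have h : f (simplexChain S σ) = Finsupp.single σ 1 := chainDesc_simplexChain S _ σ
    change ofFinsupp S n (f (simplexChain S σ)) = simplexChain S σ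
    rw [h, ofFinsupp, Finsupp.linearCombination_single, one_smul]
  exact fun a => ⟨f a, congr($this a)⟩

theorem real_ofFinsupp (n : ℕ) (a : S _⦋n⦌ →₀ ℤ) :
    J.real n (ofFinsupp S n a) = Finsupp.mapDomain (J.map n) a := by
  suffices (J.real n).toIntLinearMap ∘ₗ ofFinsupp S n = Finsupp.lmapDomain ℤ ℤ (J.map n) from
    congr($this a)
  refine Finsupp.lhom_ext' fun σ => LinearMap.ext_ring ?_
  simp [ofFinsupp, real_simplexChain]

theorem real_injective (n : ℕ) : Function.Injective (J.real n) := by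
  intro a b h
  obtain ⟨a, rfl⟩ := ofFinsupp_surjective n a
  obtain ⟨b, rfl⟩ := ofFinsupp_surjective n b
  rw [real_ofFinsupp, real_ofFinsupp] at h
  rw [Finsupp.mapDomain_injective (J.injective n) h]

theorem real_mem (n : ℕ) (a : (S.chainComplex coeffZ.{u}).X n) :
    J.real n a ∈ chainsOf (fun n => range (J.map n)) n := by
  classical
  obtain ⟨a, rfl⟩ := ofFinsupp_surjective n a
  rw [real_ofFinsupp]
  intro σ hσ
  obtain ⟨τ, -, rfl⟩ := Finset.mem_image.1 (Finsupp.mapDomain_support hσ)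
  exact mem_range_self τ

theorem exists_real_eq {n : ℕ} {a : MapChain X n}
    (ha : a ∈ chainsOf (fun n => range (J.map n)) n) : ∃ b, J.real n b = a :=
  ⟨ofFinsupp S n (a.comapDomain (J.map n) (J.injective n).injOn), by
    rw [real_ofFinsupp, Finsupp.mapDomain_comapDomain _ (J.injective n) _ ha]⟩

theorem real_d (n : ℕ) (a : (S.chainComplex coeffZ.{u}).X (n + 1)) :
    J.real n ((S.chainComplex coeffZ.{u}).d (n + 1) n a) = boundary n (J.real (n + 1) a) := by
  suffices (S.chainComplex coeffZ.{u}).d (n + 1) n ≫ AddCommGrpCat.ofHom (J.real n) =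
      AddCommGrpCat.ofHom (J.real (n + 1)) ≫
        AddCommGrpCat.ofHom (boundary (X := X) n).toAddMonoidHom from congr($this a)
  refine hom_ext_simplexChain fun σ => ?_
  change J.real n ((S.chainComplex coeffZ.{u}).d (n + 1) n (simplexChain S σ)) =
    boundary n (J.real (n + 1) (simplexChain S σ))
  rw [d_simplexChain, real_simplexChain, boundary_single, map_sum]
  simp only [map_zsmul, real_simplexChain, J.map_δ]

theorem isCycle_real {n : ℕ} {a : (S.chainComplex coeffZ.{u}).X n} :
    IsCycle (J.real n a) ↔ (S.chainComplex coeffZ.{u}).d n ((ComplexShape.down ℕ).next n) a = 0 := by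
  cases n with
  | zero =>
    rw [HomologicalComplex.shape _ _ _ (by simp)]
    exact ⟨fun _ => rfl, fun _ => trivial⟩
  | succ n =>
    rw [ChainComplex.next_nat_succ, ← (J.real_injective n).eq_iff, real_d, map_zero]
    rfl

theorem real_chainComplexMap {T : SSet.{u}} (K : MapRealization T X) (f : S ⟶ T)
    (hf : ∀ n (σ : S _⦋n⦌), K.map n (f.app _ σ) = J.map n σ) (n : ℕ)
    (a : (S.chainComplex coeffZ.{u}).X n) :
    K.real n ((SSet.chainComplexMap f coeffZ.{u}).f n a) = J.real n a := by
  suffices (SSet.chainComplexMap f coeffZ.{u}).f n ≫ AddCommGrpCat.ofHom (K.real n) =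
      AddCommGrpCat.ofHom (J.real n) from congr($this a)
  refine hom_ext_simplexChain fun σ => ?_
  change K.real n ((SSet.chainComplexMap f coeffZ.{u}).f n (simplexChain S σ)) =
    J.real n (simplexChain S σ)
  rw [chainComplexMap_simplexChain, real_simplexChain, real_simplexChain, hf]

end MapRealization

end Realization

universe u

/-! ### Homology classes in terms of cycles and boundaries. -/

section Homology

variable {ι : Type*} {c : ComplexShape ι}

theorem iCycles_injective (K : HomologicalComplex AddCommGrpCat.{u} c) (i : ι) :
    Function.Injective (K.iCycles i) :=
  (AddCommGrpCat.mono_iff_injective _).1 inferInstance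

theorem homologyπ_surjective (K : HomologicalComplex AddCommGrpCat.{u} c) (i : ι) :
    Function.Surjective (K.homologyπ i) :=
  (AddCommGrpCat.epi_iff_surjective _).1 inferInstance

/-- An element is a homomorphism from $\mathbb Z$, to which the universal property of the cycles
applies. -/
theorem exists_iCycles_eq (K : HomologicalComplex AddCommGrpCat.{u} c) {i : ι} {z : K.X i}
    (hz : K.d i (c.next i) z = 0) : ∃ w, K.iCycles i w = z := by
  let k : coeffZ.{u} ⟶ K.X i :=
    AddCommGrpCat.ofHom ((zmultiplesHom (K.X i) z).comp AddEquiv.ulift.toAddMonoidHom)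
  have hk (t : coeffZ.{u}) : k t = t.down • z := rfl
  have : k ≫ K.d i (c.next i) = 0 := ConcreteCategory.hom_ext _ _ fun t => by
    rw [ConcreteCategory.comp_apply, hk, map_zsmul, hz, smul_zero]
    rfl
  refine ⟨K.liftCycles k _ rfl this ⟨1⟩, congr($(K.liftCycles_i k _ rfl this) ⟨1⟩).trans ?_⟩
  rw [hk, one_smul]

theorem d_iCycles (K : HomologicalComplex AddCommGrpCat.{u} c) (i j : ι) (w : K.cycles i) :
    K.d i j (K.iCycles i w) = 0 :=
  congr($(K.iCycles_d i j) w)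

theorem homologyπ_eq_zero_iff (K : HomologicalComplex AddCommGrpCat.{u} c) {i j : ι}
    (hj : c.prev i = j) (w : K.cycles i) :
    K.homologyπ i w = 0 ↔ ∃ v, K.d j i v = K.iCycles i w := by
  have h (v) : K.iCycles i (K.toCycles j i v) = K.d j i v := congr($(K.toCycles_i j i) v)
  constructor
  · intro hw
    have := (ShortComplex.exact_of_g_is_cokernel (ShortComplex.mk (K.toCycles j i) (K.homologyπ i)
      (by simp)) (K.homologyIsCokernel j i hj))
    obtain ⟨v, hv⟩ := (ShortComplex.ab_exact_iff _).1 this w hw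
    exact ⟨v, (h v).symm.trans (congrArg _ hv)⟩
  · rintro ⟨v, hv⟩
    have : K.toCycles j i v = w := iCycles_injective K i ((h v).trans hv)
    rw [← this]
    exact congr($(K.toCycles_comp_homologyπ j i) v)

variable {K L : HomologicalComplex AddCommGrpCat.{u} c} (f : K ⟶ L)

theorem homologyMap_homologyπ (i : ι) (w : K.cycles i) :
    HomologicalComplex.homologyMap f i (K.homologyπ i w) =
      L.homologyπ i (HomologicalComplex.cyclesMap f i w) :=
  congr($(HomologicalComplex.homologyπ_naturality f i) w)

theorem iCycles_cyclesMap (i : ι) (w : K.cycles i) :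
    L.iCycles i (HomologicalComplex.cyclesMap f i w) = f.f i (K.iCycles i w) :=
  congr($(HomologicalComplex.cyclesMap_i f i) w)

/-- A criterion on cycles for a chain map to induce an isomorphism in homology. -/
theorem homologyMap_bijective {i j : ι} (hj : c.prev i = j)
    (hinj : ∀ z, K.d i (c.next i) z = 0 → ∀ v, L.d j i v = f.f i z → ∃ u, K.d j i u = z)
    (hsurj : ∀ z, L.d i (c.next i) z = 0 → ∃ w, K.d i (c.next i) w = 0 ∧
      ∃ v, L.d j i v = f.f i w - z) :
    Function.Bijective (HomologicalComplex.homologyMap f i) := by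
  constructor
  · rw [injective_iff_map_eq_zero]
    intro x hx
    obtain ⟨w, rfl⟩ := homologyπ_surjective K i x
    rw [homologyMap_homologyπ, homologyπ_eq_zero_iff L hj] at hx
    obtain ⟨v, hv⟩ := hx
    rw [iCycles_cyclesMap] at hv
    exact (homologyπ_eq_zero_iff K hj w).2 (hinj _ (d_iCycles K i _ w) v hv)
  · intro y
    obtain ⟨z, rfl⟩ := homologyπ_surjective L i y
    obtain ⟨w, hw, v, hv⟩ := hsurj _ (d_iCycles L i _ z)
    obtain ⟨w, rfl⟩ := exists_iCycles_eq K hw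
    refine ⟨K.homologyπ i w, ?_⟩
    rw [homologyMap_homologyπ, ← sub_eq_zero, ← map_sub, homologyπ_eq_zero_iff L hj]
    exact ⟨v, by rw [hv, map_sub, iCycles_cyclesMap]⟩

end Homology

/-! ### Singular homology against $\epsilon$-homology. -/

section Comparison

variable (X : Type u)

/-- Singular simplices are maps from simplices. -/
def singularRealization [TopologicalSpace X] :
    MapRealization (TopCat.toSSet.obj (TopCat.of X)) X where
  map _ σ := TopCat.toSSetObjEquiv (TopCat.of X) _ σ
  injective _ := DFunLike.coe_injective.comp (TopCat.toSSetObjEquiv (TopCat.of X) _).injective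
  map_δ _ _ _ := rfl

/-- `ε`-singular simplices are maps from simplices. -/
def epsRealization [PseudoEMetricSpace X] (ε : ℝ) : MapRealization (epsSing X ε) X where
  map _ σ := σ.1
  injective _ := Subtype.val_injective
  map_δ _ _ _ := rfl

theorem range_singularRealization [TopologicalSpace X] (n : ℕ) :
    range ((singularRealization X).map n) = {σ | Continuous σ} := by
  ext σ
  constructor
  · rintro ⟨τ, rfl⟩
    exact ContinuousMap.continuous _
  · intro hσ
    exact ⟨(TopCat.toSSetObjEquiv (TopCat.of X) _).symm ⟨σ, hσ⟩, by
      simp [singularRealization]⟩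

theorem range_epsRealization [PseudoEMetricSpace X] (ε : ℝ) (n : ℕ) :
    range ((epsRealization X ε).map n) = {σ | EpsContinuous ε σ} := Subtype.range_val

variable {X} [EMetricSpace X] [CompleteSpace X] {r κ : ℝ≥0}

theorem singularToEps_bijective (hX : Nonempty X → HasCenters X r κ) (hκ0 : 0 < κ)
    (hκ1 : κ < 1) {ε : ℝ} (hε : 0 < ε) (hεr : ε ≤ r) (n : ℕ) :
    Function.Bijective (singularToEps X hε n) := by
  have hs : ∀ m, chainsOf (fun n => range ((singularRealization X).map n)) m =
      contChains X m := fun m => by simp only [range_singularRealization]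
  have he : ∀ m, chainsOf (fun n => range ((epsRealization X ε).map n)) m =
      epsChains X ε m := fun m => by simp only [range_epsRealization]
  have hmap := (singularRealization X).real_chainComplexMap (epsRealization X ε)
    (singToEpsSing X hε) fun n σ => rfl
  refine homologyMap_bijective (SSet.chainComplexMap (singToEpsSing X hε) coeffZ.{u})
    (ChainComplex.prev ℕ n) (fun z hz v hv => ?_) fun z hz => ?_
  · obtain ⟨b, hb, h⟩ := exists_continuous_boundary hX hκ0 hκ1 hε hεr
      (hs n ▸ (singularRealization X).real_mem n z) ((singularRealization X).isCycle_real.2 hz)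
      (he (n + 1) ▸ (epsRealization X ε).real_mem (n + 1) v)
      (by rw [← MapRealization.real_d, hv, hmap])
    obtain ⟨u, rfl⟩ := (singularRealization X).exists_real_eq ((hs (n + 1)).symm ▸ hb)
    exact ⟨u, (singularRealization X).real_injective n
      ((MapRealization.real_d _ n u).trans h)⟩
  · obtain ⟨a, ha, hcyc, b, hb, h⟩ := exists_continuous_cycle hX hκ0 hκ1 hε hεr
      (he n ▸ (epsRealization X ε).real_mem n z) ((epsRealization X ε).isCycle_real.2 hz)
    obtain ⟨w, rfl⟩ := (singularRealization X).exists_real_eq ((hs n).symm ▸ ha)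
    obtain ⟨v, rfl⟩ := (epsRealization X ε).exists_real_eq ((he (n + 1)).symm ▸ hb)
    refine ⟨w, (singularRealization X).isCycle_real.1 hcyc, v,
      (epsRealization X ε).real_injective n ?_⟩
    rw [MapRealization.real_d, h, map_sub, hmap]

end Comparison

/-! ### Stability and the inverse limit. -/

section Limit

variable {X : Type u} [PseudoEMetricSpace X] {r : ℝ} {n : ℕ}

theorem epsHomologyMap_bijective
    (h : ∀ (ε : ℝ) (hε : 0 < ε), ε ≤ r → Function.Bijective (singularToEps X hε n))
    {ε₁ ε₂ : ℝ} (h₁₂ : ε₂ ≤ ε₁) (h₂ : 0 < ε₂) (h₁ : ε₁ ≤ r) :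
    Function.Bijective (epsHomologyMap X h₁₂ n) := by
  refine (Function.Bijective.of_comp_iff _ (h ε₂ h₂ (h₁₂.trans h₁))).1 ?_
  convert h ε₁ (h₂.trans_le h₁₂) h₁ using 1
  exact funext fun a => (singularToEps_compat X h₂ _ h₁₂ n a).symm

/-- A compatible family is determined by its component at `r`: larger scales receive its image, and
for smaller ones the transition map to `r` is injective. -/
theorem singularToLc_bijective (hr : 0 < r)
    (h : ∀ (ε : ℝ) (hε : 0 < ε), ε ≤ r → Function.Bijective (singularToEps X hε n)) :
    Function.Bijective (singularToLc X n) := by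
  constructor
  · intro a b hab
    exact (h r hr le_rfl).1 (congrFun (congrArg Subtype.val hab) ⟨r, hr⟩)
  · intro a
    obtain ⟨b, hb⟩ := (h r hr le_rfl).2 (a.1 ⟨r, hr⟩)
    refine ⟨b, Subtype.ext (funext fun ε => ?_)⟩
    change singularToEps X ε.2 n b = a.1 ε
    rcases le_total (ε : ℝ) r with hε | hε
    · apply (epsHomologyMap_bijective h hε ε.2 le_rfl).1
      rw [← singularToEps_compat X ε.2 hr hε, hb]
      exact a.2 ε ⟨r, hr⟩ hε
    · rw [singularToEps_compat X hr ε.2 hε, hb]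
      exact (a.2 ⟨r, hr⟩ ε hε).symm

end Limit

end ScaledHomology

end

theorem theorem2p16 {d : ℕ} {M : Type*} [EMetricSpace M] [CompactSpace M]
    [ChartedSpace (EuclideanSpace ℝ (Fin d)) M] [IsManifold (𝓡 d) ∞ M]
    [Bundle.RiemannianBundle (fun x : M => TangentSpace (𝓡 d) x)]
    [IsContMDiffRiemannianBundle (𝓡 d) ∞ (EuclideanSpace ℝ (Fin d))
      (fun x : M => TangentSpace (𝓡 d) x)]
    [IsRiemannianManifold (𝓡 d) M] :
    (∀ n : ℕ, Function.Bijective (ScaledHomology.singularToLc M n)) ∧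
    (∃ δ : ℝ, 0 < δ ∧ ∀ (ε : ℝ) (hε : 0 < ε), ε < δ → ∀ n : ℕ,
      Function.Bijective (ScaledHomology.singularToEps M hε n)) ∧
    (∀ n : ℕ, ScaledHomology.LcStable M n) := by
  obtain ⟨r, hr, hM⟩ := ScaledHomology.exists_hasCenters_of_isRiemannianManifold (M := M) (d := d)
  have key (n : ℕ) (ε : ℝ) (hε : 0 < ε) (h : ε ≤ r) :
      Function.Bijective (ScaledHomology.singularToEps M hε n) :=
    ScaledHomology.singularToEps_bijective hM (by positivity)
      ((div_lt_one (by norm_num)).2 (by norm_num)) hε h n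
  exact ⟨fun n => ScaledHomology.singularToLc_bijective hr (key n),
    ⟨r, hr, fun ε hε h n => key n ε hε h.le⟩,
    fun n => ⟨r, hr, fun _ _ h₁₂ h₂ h₁ =>
      ScaledHomology.epsHomologyMap_bijective (key n) h₁₂ h₂ h₁⟩⟩
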